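/- All directed graphs are finite, without parallel edges. For a directed graph $G=(V,E)$ and $s,t\in V$, let $\text{max-flow}(s,t,G)$ be the maximum value of a flow from $s$ to $t$ in $G$ when every edge has capacity $1$. For a source $s\in V$ and an integer $r\ge 0$, an $r$-fault-tolerant reachability subgraph ($r$-FTRS) of $G$ is a subgraph $H=(V,E_H)$, $E_H\subseteq E$, such that for every $F\subseteq E$ with $|F|\le r$ and every $v\in V$, the vertex $v$ is reachable from $s$ in $H\setminus F$ if and only if it is reachable from $s$ in $G\setminus F$. **Theorem.** There is an algorithm with the following property. Let $G$ be a directed graph with $n$ vertices and $m$ edges, let $s$ be a designated source, let $t$ be a vertex with $\text{max-flow}(s,t,G)=f$ for some positive integer $f$, and let $k\ge 1$ be an integer. Given $(G,s,t,k)$, with $G$ as a list of its edges, the algorithm computes in $O(2^k f m)$ time a $(k+f-1)$-FTRS $H$ of $G$ for the source $s$ in which the in-degree of $t$ is at most $2^k f$, and outputs $H$ as a list of its edges. The running time is the number of steps on a unit-cost random access machine (with constants, addition, truncated subtraction, indirect addressing, and tests for zero, and with memory initially zero outside the input), and the constant in $O(\cdot)$ is absolute. -/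

import Mathlib

namespace FTReach

/-! ### Digraphs, flows and fault-tolerant reachability subgraphs -/

section Graph

variable {V : Type*}

/-- The edge set of a digraph. -/
def edges (G : Digraph V) : Set (V × V) := {e | G.Adj e.1 e.2}

/-- The digraph `G ∖ F`, obtained from `G` by deleting the edges in `F`. -/
def deleteEdges (G : Digraph V) (F : Finset (V × V)) : Digraph V where
  Adj u v := G.Adj u v ∧ (u, v) ∉ F

/-- There is a directed path (possibly of length zero) from `s` to `v` in `G`. -/
def Reachable (G : Digraph V) (s v : V) : Prop := Relation.ReflTransGen G.Adj s v

/-- The number of edges of `G` that enter `v`. -/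
noncomputable def inDegree (G : Digraph V) (v : V) : ℕ := {u | G.Adj u v}.ncard

/-- A feasible `(s, t)`-flow in `G`, every edge having capacity one. -/
structure IsFlow [Fintype V] (G : Digraph V) (s t : V) (g : V → V → ℝ) : Prop where
  nonneg : ∀ u v, 0 ≤ g u v
  le_one : ∀ u v, g u v ≤ 1
  supported : ∀ u v, ¬ G.Adj u v → g u v = 0
  conserved : ∀ v, v ≠ s → v ≠ t → ∑ u, g u v = ∑ w, g v w

/-- The value of a flow with source `s`: the net amount of flow that leaves `s`. -/
def flowValue [Fintype V] (s : V) (g : V → V → ℝ) : ℝ := ∑ w, g s w - ∑ u, g u s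

/-- `max-flow(s, t, G) = x`. (For `s = t` every flow has value zero.) -/
def IsMaxFlowValue [Fintype V] (G : Digraph V) (s t : V) (x : ℝ) : Prop :=
  IsGreatest {y | ∃ g, IsFlow G s t g ∧ flowValue s g = y} x

/-- `H` is an `r`-fault-tolerant reachability subgraph of `G` for the source `s`: it is a subgraph,
on all the vertices of `G`, and after the failure of any set `F` of at most `r` edges of `G`,
the same vertices are reachable from `s` in `H ∖ F` as in `G ∖ F`. -/
def IsFTRS (G : Digraph V) (s : V) (r : ℕ) (H : Digraph V) : Prop :=
  H ≤ G ∧ ∀ F : Finset (V × V), (F : Set (V × V)) ⊆ edges G → F.card ≤ r →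
    ∀ v, Reachable (deleteEdges H F) s v ↔ Reachable (deleteEdges G F) s v

end Graph

/-! ### Random access machines with unit costs -/

/-- A configuration of the machine: registers, random access memory, and what has been output. -/
structure State where
  reg : ℕ → ℕ
  mem : ℕ → ℕ
  out : List ℕ

/-- Arithmetic expressions: constants, registers, the memory cell at a computed address, addition
and truncated subtraction. -/
inductive Expr where
  | lit (c : ℕ)
  | reg (r : ℕ)
  | load (a : Expr)
  | add (a b : Expr)
  | sub (a b : Expr)

/-- The value of an expression. -/
def Expr.eval (σ : State) : Expr → ℕ
  | .lit c => c
  | .reg r => σ.reg r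
  | .load a => σ.mem (a.eval σ)
  | .add a b => a.eval σ + b.eval σ
  | .sub a b => a.eval σ - b.eval σ

/-- The number of steps needed to evaluate an expression: one for each node. -/
def Expr.cost : Expr → ℕ
  | .lit _ => 1
  | .reg _ => 1
  | .load a => a.cost + 1
  | .add a b => a.cost + b.cost + 1
  | .sub a b => a.cost + b.cost + 1

/-- Programs. A test succeeds when the value of its expression is nonzero. -/
inductive Prog where
  | skip
  | assign (r : ℕ) (e : Expr)
  | store (a e : Expr)
  | emit (e : Expr)
  | seq (p q : Prog)
  | branch (e : Expr) (p q : Prog)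
  | loop (e : Expr) (p : Prog)

/-- `Exec p σ T τ`: the program `p`, started in the configuration `σ`, halts after exactly `T` steps
in the configuration `τ`. -/
inductive Exec : Prog → State → ℕ → State → Prop
  | skip (σ : State) : Exec .skip σ 1 σ
  | assign (σ : State) (r : ℕ) (e : Expr) :
      Exec (.assign r e) σ (e.cost + 1) { σ with reg := Function.update σ.reg r (e.eval σ) }
  | store (σ : State) (a e : Expr) :
      Exec (.store a e) σ (a.cost + e.cost + 1)
        { σ with mem := Function.update σ.mem (a.eval σ) (e.eval σ) }
  | emit (σ : State) (e : Expr) :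
      Exec (.emit e) σ (e.cost + 1) { σ with out := σ.out ++ [e.eval σ] }
  | seq {p q : Prog} {σ τ υ : State} {T U : ℕ} :
      Exec p σ T τ → Exec q τ U υ → Exec (.seq p q) σ (T + U) υ
  | branch_true {e : Expr} {p q : Prog} {σ τ : State} {T : ℕ} :
      e.eval σ ≠ 0 → Exec p σ T τ → Exec (.branch e p q) σ (e.cost + 1 + T) τ
  | branch_false {e : Expr} {p q : Prog} {σ τ : State} {T : ℕ} :
      e.eval σ = 0 → Exec q σ T τ → Exec (.branch e p q) σ (e.cost + 1 + T) τ
  | loop_done {e : Expr} {p : Prog} {σ : State} :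
      e.eval σ = 0 → Exec (.loop e p) σ (e.cost + 1) σ
  | loop_step {e : Expr} {p : Prog} {σ τ υ : State} {T U : ℕ} :
      e.eval σ ≠ 0 → Exec p σ T τ → Exec (.loop e p) τ U υ →
        Exec (.loop e p) σ (e.cost + 1 + T + U) υ

/-- The initial configuration on an input: the input fills the first memory cells, all the other
cells and all the registers hold zero, and nothing has been output. -/
def initState (input : List ℕ) : State where
  reg _ := 0
  mem i := input.getD i 0
  out := []

/-- On the given input, `p` halts within `T` steps, having output exactly the given list. -/
def Computes (p : Prog) (input : List ℕ) (T : ℕ) (output : List ℕ) : Prop :=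
  ∃ T' ≤ T, ∃ τ, Exec p (initState input) T' τ ∧ τ.out = output

/-- The list `L` enumerates the edges of `G`, each of them once, in some order. -/
def IsEdgeList {n : ℕ} (G : Digraph (Fin n)) (L : List (Fin n × Fin n)) : Prop :=
  L.Nodup ∧ ∀ e, e ∈ L ↔ e ∈ edges G

/-- A list of pairs of vertices as a list of numbers. -/
def encodeEdges {n : ℕ} (L : List (Fin n × Fin n)) : List ℕ :=
  L.flatMap fun e => [(e.1 : ℕ), (e.2 : ℕ)]

/-- The encoding of a problem instance: the numbers of vertices and edges, the source, the
destination, the parameter, and the edge list. -/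
def encodeInput {n : ℕ} (L : List (Fin n × Fin n)) (s t : Fin n) (k : ℕ) : List ℕ :=
  [n, L.length, (s : ℕ), (t : ℕ), k] ++ encodeEdges L

end FTReach

/-!
The algorithm keeps a set `S` of sources, initially `{s}`, supplies `c v` that vertices may draw
in addition, initially zero, and an integral flow. In a stage, it augments the flow until it is
maximum, by searching backwards from `t` in the residual network. The vertices that the last
search has not reached form the farthest minimum cut `A`. Then `A` becomes the set of sources, and
every edge from `A` to a vertex `y ≠ t` outside increases the supply of `y` by one. So a vertex
beyond the cut can draw one more unit for each cut edge that enters it, the capacity of `A` at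
most doubles (`Net.cut_bump_le`), and the old flow stays a flow. After `k` stages the maximum flow
has value at most `2 ^ k * f`, and of the edges into `t` the algorithm keeps just those that this
flow uses.

Suppose that this loses `t` for some set `F` of failures, and let `X` be the set of vertices still
reachable from `s`. All kept edges that leave `X` lie in `F`, so it suffices to find `k + f` of
them. By submodularity, the cuts `X ∪ Aᵢ` are compared with each other from the last stage down to
the first. The path to `t` that the full graph still has leaves each `X ∩ Aᵢ` by an edge whose
head lies in `X`, outside `Aᵢ`, and is not `t`. This head either belongs to `Aᵢ₊₁`, so that `(X ∪
Aᵢ) ∩ Aᵢ₊₁` is not inside the largest minimum cut `Aᵢ`, or else keeps a supply that the cut `X ∪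
Aᵢ₊₁` does not have to pay for; in either case one unit is gained (`Net.Stage.le_crossing`, used
in `Net.Represents.isFTRS`).

For the running time, every search, augmentation and transition between stages costs a constant
for each edge (`round_triple`). Each round raises the value of the flow or completes a stage, so
there are at most `2 ^ k * f + k + 1` rounds (`rounds_triple`). Searches run over the half-edges,
which are linked into incidence lists, and marks carry the number of the search, so that no time
is spent on vertices without edges or on clearing memory. The machine is handled through Hoare
triples over named variables and unbounded arrays, which are interleaved behind the input
(`Realizes`).
-/

namespace FTReach

/-! ### Straight-line code and Hoare triples over named variables and arrays -/

/-- The named registers of the program. -/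
inductive Var where
  | edgeCount | source | target | stages | stamp | queueHead | queueTail | node | succ | vertex
  | found | walker | counter | cursor | tail | head
  deriving DecidableEq

/-- The named arrays of the program. Half-edges index `site` (the vertex at which one sits),
`partner` (the other end of the edge), `next` (the successor in the incidence list), `residual` and
`mark`; vertices index `first` (the head of the incidence list), `via` (the half-edge through which
a search came), `inSource` and `supply`. -/
inductive Arr where
  | site | partner | next | first | residual | mark | queue | via | inSource | supply
  deriving DecidableEq

/-- The register that holds a variable. Register zero holds the first address behind the input. -/
def Var.index : Var → ℕ
  | .edgeCount => 1 | .source => 2 | .target => 3 | .stages => 4 | .stamp => 5 | .queueHead => 6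
  | .queueTail => 7 | .node => 8 | .succ => 9 | .vertex => 10 | .found => 11 | .walker => 12
  | .counter => 13 | .cursor => 14 | .tail => 15 | .head => 16

/-- The residue modulo 16 of the addresses, relative to the end of the input, of an array. -/
def Arr.index : Arr → ℕ
  | .site => 0 | .partner => 1 | .next => 2 | .first => 3 | .residual => 4 | .mark => 5
  | .queue => 6 | .via => 7 | .inSource => 8 | .supply => 9

theorem Var.index_injective : Function.Injective Var.index := by
  intro a b h
  cases a <;> cases b <;> first | rfl | (simp [Var.index] at h)

theorem Var.index_pos (v : Var) : v.index ≠ 0 := by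
  cases v <;> simp [Var.index]

theorem Arr.index_injective : Function.Injective Arr.index := by
  intro a b h
  cases a <;> cases b <;> first | rfl | (simp [Arr.index] at h)

theorem Arr.index_lt (a : Arr) : a.index < 16 := by
  cases a <;> simp [Arr.index]

/-- A configuration seen through the named variables and arrays. The arrays are unbounded. -/
structure View where
  var : Var → ℕ
  arr : Arr → ℕ → ℕ
  out : List ℕ

namespace View

/-- Overwrite a variable. -/
def setVar (h : View) (v : Var) (x : ℕ) : View :=
  { h with var := Function.update h.var v x }

/-- Overwrite an array entry. -/
def setArr (h : View) (a : Arr) (i x : ℕ) : View :=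
  { h with arr := Function.update h.arr a (Function.update (h.arr a) i x) }

/-- Append to the output. -/
def print (h : View) (x : ℕ) : View :=
  { h with out := h.out ++ [x] }

variable (h : View) (v w : Var) (a b : Arr) (i x : ℕ)

@[simp] theorem setVar_var_self : (h.setVar v x).var v = x := by simp [setVar]
@[simp] theorem setVar_var_of_ne (hw : w ≠ v) : (h.setVar v x).var w = h.var w := by
  simp [setVar, hw]
@[simp] theorem setVar_arr : (h.setVar v x).arr = h.arr := rfl
@[simp] theorem setVar_out : (h.setVar v x).out = h.out := rfl
@[simp] theorem setArr_arr_self : (h.setArr a i x).arr a = Function.update (h.arr a) i x := by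
  simp [setArr]
@[simp] theorem setArr_arr_of_ne (hb : b ≠ a) : (h.setArr a i x).arr b = h.arr b := by
  simp [setArr, hb]
@[simp] theorem setArr_var : (h.setArr a i x).var = h.var := rfl
@[simp] theorem setArr_out : (h.setArr a i x).out = h.out := rfl
@[simp] theorem print_arr : (h.print x).arr = h.arr := rfl
@[simp] theorem print_var : (h.print x).var = h.var := rfl
@[simp] theorem print_out : (h.print x).out = h.out ++ [x] := rfl

end View

/-- Expressions over named variables and arrays; `input` reads a cell of the input. -/
inductive Term where
  | lit (c : ℕ)
  | var (v : Var)
  | input (a : Term)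
  | get (a : Arr) (i : Term)
  | add (a b : Term)
  | sub (a b : Term)

namespace Term

/-- The value of an expression on a given input. -/
def eval (I : List ℕ) (h : View) : Term → ℕ
  | lit c => c
  | var v => h.var v
  | input a => I.getD (a.eval I h) 0
  | get a i => h.arr a (i.eval I h)
  | add a b => a.eval I h + b.eval I h
  | sub a b => a.eval I h - b.eval I h

end Term

/-- The address of an array entry: `16 i` plus the offset of the array, behind the input. -/
def address (a : Arr) (i : Expr) : Expr :=
  let i₂ := i.add i
  let i₄ := i₂.add i₂
  let i₈ := i₄.add i₄
  ((Expr.reg 0).add (.lit a.index)).add (i₈.add i₈)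

/-- The machine expression that evaluates a term. -/
def Term.compile : Term → Expr
  | lit c => .lit c
  | var v => .reg v.index
  | input a => .load a.compile
  | get a i => .load (address a i.compile)
  | add a b => .add a.compile b.compile
  | sub a b => .sub a.compile b.compile

/-- The reads from the input that an expression makes stay inside the input. -/
def Term.Safe (I : List ℕ) (h : View) : Term → Prop
  | lit _ => True
  | var _ => True
  | input a => a.Safe I h ∧ a.eval I h < I.length
  | get _ i => i.Safe I h
  | add a b => a.Safe I h ∧ b.Safe I h
  | sub a b => a.Safe I h ∧ b.Safe I h

/-- The machine configuration `σ` realizes the view `h` on the input `I`. -/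
structure Realizes (I : List ℕ) (h : View) (σ : State) : Prop where
  base : σ.reg 0 = I.length
  var : ∀ v, σ.reg v.index = h.var v
  arr : ∀ a i, σ.mem (I.length + a.index + 16 * i) = h.arr a i
  input : ∀ i, i < I.length → σ.mem i = I.getD i 0
  out : σ.out = h.out

theorem address_eval {I : List ℕ} {h : View} {σ : State} (hr : Realizes I h σ) (a : Arr)
    (i : Expr) : (address a i).eval σ = I.length + a.index + 16 * i.eval σ := by
  simp only [address, Expr.eval, hr.base]
  ring

theorem Term.compile_eval {I : List ℕ} {h : View} {σ : State} (hr : Realizes I h σ) :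
    ∀ e : Term, e.Safe I h → e.compile.eval σ = e.eval I h
  | .lit _, _ => rfl
  | .var v, _ => hr.var v
  | .input a, hs => by
    have := a.compile_eval hr hs.1
    simp only [compile, Expr.eval, eval, this]
    exact hr.input _ hs.2
  | .get a i, hs => by
    have := i.compile_eval hr hs
    simp only [compile, Expr.eval, eval, address_eval hr, this]
    exact hr.arr _ _
  | .add a b, hs => by
    simp only [compile, Expr.eval, eval, a.compile_eval hr hs.1, b.compile_eval hr hs.2]
  | .sub a b, hs => by
    simp only [compile, Expr.eval, eval, a.compile_eval hr hs.1, b.compile_eval hr hs.2]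

/-- Programs without loops, over named variables and arrays. -/
inductive Code where
  | skip
  | assign (v : Var) (e : Term)
  | store (a : Arr) (i e : Term)
  | emit (e : Term)
  | seq (p q : Code)
  | cond (e : Term) (p q : Code)

namespace Code

/-- The machine program of a piece of code. -/
def compile : Code → Prog
  | skip => .skip
  | assign v e => .assign v.index e.compile
  | store a i e => .store (address a i.compile) e.compile
  | emit e => .emit e.compile
  | seq p q => .seq p.compile q.compile
  | cond e p q => .branch e.compile p.compile q.compile

/-- A bound for the number of steps of a piece of code; at a branching the costs are added up. -/
def cost : Code → ℕ
  | skip => 1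
  | assign _ e => e.compile.cost + 1
  | store a i e => (address a i.compile).cost + e.compile.cost + 1
  | emit e => e.compile.cost + 1
  | seq p q => p.cost + q.cost
  | cond e p q => e.compile.cost + 1 + (p.cost + q.cost)

/-- The weakest precondition of a piece of code. -/
def wp (I : List ℕ) : Code → (View → Prop) → View → Prop
  | skip, Q, h => Q h
  | assign v e, Q, h => e.Safe I h ∧ Q (h.setVar v (e.eval I h))
  | store a i e, Q, h => i.Safe I h ∧ e.Safe I h ∧ Q (h.setArr a (i.eval I h) (e.eval I h))
  | emit e, Q, h => e.Safe I h ∧ Q (h.print (e.eval I h))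
  | seq p q, Q, h => p.wp I (q.wp I Q) h
  | cond e p q, Q, h =>
    e.Safe I h ∧ (e.eval I h ≠ 0 → p.wp I Q h) ∧ (e.eval I h = 0 → q.wp I Q h)

theorem wp_mono {I : List ℕ} : ∀ (p : Code) {Q R : View → Prop} {h : View},
    p.wp I Q h → (∀ h, Q h → R h) → p.wp I R h
  | skip, _, _, _, hw, hQ => hQ _ hw
  | assign _ _, _, _, _, hw, hQ => ⟨hw.1, hQ _ hw.2⟩
  | store _ _ _, _, _, _, hw, hQ => ⟨hw.1, hw.2.1, hQ _ hw.2.2⟩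
  | emit _, _, _, _, hw, hQ => ⟨hw.1, hQ _ hw.2⟩
  | seq p q, _, _, _, hw, hQ => p.wp_mono hw fun _ hq => q.wp_mono hq hQ
  | cond _ p q, _, _, _, hw, hQ =>
    ⟨hw.1, fun he => p.wp_mono (hw.2.1 he) hQ, fun he => q.wp_mono (hw.2.2 he) hQ⟩

end Code

/-- The program `p`, started in a realization of the view `h`, halts within `T` steps in a
realization of a view that satisfies `Q`. -/
def Triple (I : List ℕ) (h : View) (p : Prog) (T : ℕ) (Q : View → Prop) : Prop :=
  ∀ σ, Realizes I h σ → ∃ T' ≤ T, ∃ τ h', Exec p σ T' τ ∧ Realizes I h' τ ∧ Q h'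

namespace Triple

variable {I : List ℕ} {h : View}

theorem seq {p q : Prog} {T U : ℕ} {Q R : View → Prop} (hp : Triple I h p T Q)
    (hq : ∀ h', Q h' → Triple I h' q U R) : Triple I h (.seq p q) (T + U) R := by
  intro σ hσ
  obtain ⟨T', hT, τ, h', he, hr, hQ⟩ := hp σ hσ
  obtain ⟨U', hU, υ, h'', he', hr', hR⟩ := hq h' hQ τ hr
  exact ⟨T' + U', by omega, υ, h'', he.seq he', hr', hR⟩

theorem weaken {p : Prog} {T U : ℕ} {Q R : View → Prop} (hp : Triple I h p T Q) (hT : T ≤ U)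
    (hQ : ∀ h', Q h' → R h') : Triple I h p U R := by
  intro σ hσ
  obtain ⟨T', hT', τ, h', he, hr, hQ'⟩ := hp σ hσ
  exact ⟨T', hT'.trans hT, τ, h', he, hr, hQ _ hQ'⟩

theorem branch {e : Term} {p q : Prog} {T : ℕ} {Q : View → Prop} (hs : e.Safe I h)
    (hp : e.eval I h ≠ 0 → Triple I h p T Q) (hq : e.eval I h = 0 → Triple I h q T Q) :
    Triple I h (.branch e.compile p q) (e.compile.cost + 1 + T) Q := by
  intro σ hσ
  have hc := Term.compile_eval hσ e hs
  by_cases he : e.eval I h = 0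
  · obtain ⟨T', hT, τ, h', hx, hr, hQ⟩ := hq he σ hσ
    exact ⟨_, by omega, τ, h', .branch_false (hc.trans he) hx, hr, hQ⟩
  · obtain ⟨T', hT, τ, h', hx, hr, hQ⟩ := hp he σ hσ
    exact ⟨_, by omega, τ, h', .branch_true (hc ▸ he) hx, hr, hQ⟩

/-- The rule for loops: `J b` is an invariant that guarantees that at most `b` more rounds
follow. -/
theorem loop {e : Term} {p : Prog} {T : ℕ} {J : ℕ → View → Prop} {Q : View → Prop}
    (hs : ∀ b h, J b h → e.Safe I h)
    (hstep : ∀ b h, J b h → e.eval I h ≠ 0 → Triple I h p T fun h' => ∃ b' < b, J b' h')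
    (hdone : ∀ b h, J b h → e.eval I h = 0 → Q h) :
    ∀ (b : ℕ) (h : View), J b h →
      Triple I h (.loop e.compile p) (b * (e.compile.cost + 1 + T) + (e.compile.cost + 1)) Q := by
  intro b
  induction b using Nat.strong_induction_on with
  | _ b ih =>
    intro h hJ σ hσ
    have hc := Term.compile_eval hσ e (hs b h hJ)
    by_cases he : e.eval I h = 0
    · exact ⟨_, by omega, σ, h, .loop_done (hc.trans he), hσ, hdone b h hJ he⟩
    · obtain ⟨T', hT, τ, h', hx, hr, b', hb', hJ'⟩ := hstep b h hJ he σ hσ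
      obtain ⟨U, hU, υ, h'', hx', hr', hQ⟩ := ih b' hb' h' hJ' τ hr
      refine ⟨_, ?_, υ, h'', .loop_step (hc ▸ he) hx hx', hr', hQ⟩
      have : (b' + 1) * (e.compile.cost + 1 + T) ≤ b * (e.compile.cost + 1 + T) :=
        Nat.mul_le_mul_right _ hb'
      rw [Nat.add_mul, Nat.one_mul] at this
      omega

end Triple

theorem Realizes.setVar {I : List ℕ} {h : View} {σ : State} (hr : Realizes I h σ) (v : Var)
    (x : ℕ) : Realizes I (h.setVar v x) { σ with reg := Function.update σ.reg v.index x } where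
  base := by simpa [Function.update_of_ne v.index_pos.symm] using hr.base
  var w := by
    by_cases hw : w = v
    · subst hw; simp
    · simp [hw, Function.update_of_ne (Var.index_injective.ne hw), hr.var w]
  arr := hr.arr
  input := hr.input
  out := hr.out

theorem Realizes.setArr {I : List ℕ} {h : View} {σ : State} (hr : Realizes I h σ) (a : Arr)
    (i x : ℕ) : Realizes I (h.setArr a i x)
      { σ with mem := Function.update σ.mem (I.length + a.index + 16 * i) x } where
  base := hr.base
  var := hr.var
  arr b j := by
    by_cases hb : b = a
    · subst hb
      by_cases hj : j = i
      · subst hj; simp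
      · have : I.length + b.index + 16 * j ≠ I.length + b.index + 16 * i := by omega
        simp [Function.update_of_ne this, Function.update_of_ne hj, hr.arr b j]
    · have h₁ := a.index_lt
      have h₂ := b.index_lt
      have h₃ := Arr.index_injective.ne hb
      have : I.length + b.index + 16 * j ≠ I.length + a.index + 16 * i := by omega
      simp [Function.update_of_ne this, hb, hr.arr b j]
  input j hj := by
    have : j ≠ I.length + a.index + 16 * i := by omega
    simpa [Function.update_of_ne this] using hr.input j hj
  out := hr.out

theorem Code.triple {I : List ℕ} : ∀ (p : Code) {Q : View → Prop} {h : View},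
    p.wp I Q h → Triple I h p.compile p.cost Q
  | skip, _, h, hw => fun σ hσ => ⟨1, le_rfl, σ, h, .skip σ, hσ, hw⟩
  | assign v e, _, h, hw => fun σ hσ => by
    refine ⟨_, le_rfl, _, _, .assign σ v.index e.compile, ?_, hw.2⟩
    rw [Term.compile_eval hσ e hw.1]
    exact hσ.setVar _ _
  | store a i e, _, h, hw => fun σ hσ => by
    refine ⟨_, le_rfl, _, _, .store σ (address a i.compile) e.compile, ?_, hw.2.2⟩
    rw [address_eval hσ, Term.compile_eval hσ e hw.2.1, Term.compile_eval hσ i hw.1]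
    exact hσ.setArr _ _ _
  | emit e, _, h, hw => fun σ hσ => by
    refine ⟨_, le_rfl, _, _, .emit σ e.compile, ?_, hw.2⟩
    rw [Term.compile_eval hσ e hw.1]
    exact ⟨hσ.base, hσ.var, hσ.arr, hσ.input, by simp [hσ.out]⟩
  | seq p q, _, h, hw => (p.triple hw).seq fun _ hq => q.triple hq
  | cond e p q, _, h, hw => by
    refine Triple.branch hw.1 (fun he => ?_) (fun he => ?_)
    · exact (p.triple (hw.2.1 he)).weaken (by omega) fun _ h => h
    · exact (q.triple (hw.2.2 he)).weaken (by omega) fun _ h => h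

/-- The view that the program starts with: everything is zero. -/
def View.zero : View := ⟨fun _ => 0, fun _ _ => 0, []⟩

/-- Once register zero holds the length of the input, the initial configuration realizes the view
in which everything is zero. -/
theorem computes_of_triple {I : List ℕ} {e : Expr} {p : Prog} {T : ℕ} {Q : List ℕ → Prop}
    (he : e.eval (initState I) = I.length)
    (hp : Triple I View.zero p T fun h => Q h.out) :
    ∃ O, Q O ∧ Computes (.seq (.assign 0 e) p) I (e.cost + 1 + T) O := by
  have hr : Realizes I View.zero
      { initState I with reg := Function.update (initState I).reg 0 (e.eval (initState I)) } := by
    refine ⟨by simp [he], fun v => ?_, fun a i => ?_, fun i _ => rfl, rfl⟩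
    · simp [Function.update_of_ne v.index_pos, initState, View.zero]
    · simp only [initState, View.zero]
      exact List.getD_eq_default _ _ (by omega)
  obtain ⟨T', hT, τ, h', hx, hr', hQ⟩ := hp _ hr
  exact ⟨h'.out, hQ, e.cost + 1 + T', by omega, τ, (Exec.assign _ _ _).seq hx, hr'.out⟩

/-! ### Cuts with supplies -/

/-- A finite directed multigraph: edges indexed by `ι`, vertices `V`. -/
structure Net (V ι : Type*) where
  tail : ι → V
  head : ι → V

namespace Net

open Finset

set_option linter.unusedSectionVars false

variable {V ι : Type*} [Fintype V] [DecidableEq V] [Fintype ι] [DecidableEq ι] (N : Net V ι)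

/-- The number of edges in `K` that leave `X`. -/
def crossing (K : Finset ι) (X : Finset V) : ℕ := #{e ∈ K | N.tail e ∈ X ∧ N.head e ∉ X}

/-- The capacity of the cut `X` in the network with edge set `K` in which every vertex `v` moreover
can draw `c v` units from the source directly. -/
def cut (K : Finset ι) (c : V → ℕ) (X : Finset V) : ℕ := N.crossing K X + ∑ v ∈ Xᶜ, c v

/-- The number of edges that enter `v` from `A`; zero for `v = t`. -/
def bump (t : V) (A : Finset V) (v : V) : ℕ :=
  if v = t then 0 else #{e | N.tail e ∈ A ∧ N.head e = v}

/-- `A` is the largest among the minimum cuts, with supplies `c`, between `S` and `t`. -/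
structure IsFarthestMinCut (t : V) (S : Finset V) (c : V → ℕ) (A : Finset V) : Prop where
  subset : S ⊆ A
  target : t ∉ A
  le : ∀ X, S ⊆ X → t ∉ X → N.cut univ c A ≤ N.cut univ c X
  largest : ∀ X, S ⊆ X → t ∉ X → N.cut univ c X = N.cut univ c A → X ⊆ A

/-- The networks of the successive stages: the sources `S` and the supplies `c` after `i` farthest
minimum cuts. The side `A` of the cut becomes the set of sources, and each vertex beyond the
cut is supplied with one more unit for each edge of the cut that enters it. -/
inductive Stage (s t : V) (f : ℕ) : ℕ → Finset V → (V → ℕ) → Prop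
  | zero : Stage s t f 0 {s} 0
  | succ {i : ℕ} {S A : Finset V} {c : V → ℕ} : Stage s t f i S c →
      N.IsFarthestMinCut t S c A → N.cut univ c A ≤ 2 ^ i * f →
      Stage s t f (i + 1) A (c + N.bump t A)

theorem crossing_submodular (K : Finset ι) (X Y : Finset V) :
    N.crossing K (X ∩ Y) + N.crossing K (X ∪ Y) ≤ N.crossing K X + N.crossing K Y := by
  simp only [crossing, card_filter, ← sum_add_distrib]
  refine sum_le_sum fun e _ => ?_
  simp only [mem_inter, mem_union]
  by_cases h₁ : N.tail e ∈ X <;> by_cases h₂ : N.tail e ∈ Y <;>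
    by_cases h₃ : N.head e ∈ X <;> by_cases h₄ : N.head e ∈ Y <;> simp [h₁, h₂, h₃, h₄]

theorem crossing_eq_univ {K : Finset ι} {A X : Finset V} (hX : X ⊆ A)
    (hK : ∀ e, N.tail e ∈ A → N.head e ∉ X → e ∈ K) :
    N.crossing K X = N.crossing univ X := by
  unfold crossing
  congr 1
  ext e
  simp only [mem_filter, mem_univ, true_and]
  exact ⟨fun h => h.2, fun h => ⟨hK e (hX h.1) h.2, h⟩⟩

/-- Submodularity of cuts for two networks, of which the second has additional supplies `b`. -/
theorem cut_submodular (K : Finset ι) (c b : V → ℕ) (X Y : Finset V) :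
    N.cut K c (X ∩ Y) + N.cut K (c + b) (X ∪ Y) + ∑ v ∈ X \ Y, b v ≤
      N.cut K c X + N.cut K (c + b) Y := by
  have h := N.crossing_submodular K X Y
  have : ∑ v ∈ (X ∩ Y)ᶜ, c v + ∑ v ∈ (X ∪ Y)ᶜ, (c + b) v + ∑ v ∈ X \ Y, b v
      = ∑ v ∈ Xᶜ, c v + ∑ v ∈ Yᶜ, (c + b) v := by
    have key : ∀ (Z : Finset V) (w : V → ℕ), ∑ v ∈ Z, w v = ∑ v, if v ∈ Z then w v else 0 := by
      intro Z w
      simp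
    rw [key _ c, key _ (c + b), key _ b, key _ c, key _ (c + b), ← sum_add_distrib,
      ← sum_add_distrib, ← sum_add_distrib]
    refine sum_congr rfl fun v _ => ?_
    simp only [mem_compl, mem_inter, mem_union, mem_sdiff, Pi.add_apply]
    by_cases h₁ : v ∈ X <;> by_cases h₂ : v ∈ Y <;> simp [h₁, h₂]
  unfold cut
  omega

/-- The new supplies at most double the capacity of the cut. -/
theorem cut_bump_le (t : V) (c : V → ℕ) (A : Finset V) :
    N.cut univ (c + N.bump t A) A ≤ 2 * N.cut univ c A := by
  have : ∑ v ∈ Aᶜ, N.bump t A v ≤ N.crossing univ A := by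
    calc ∑ v ∈ Aᶜ, N.bump t A v ≤ ∑ v ∈ Aᶜ, #{e | N.tail e ∈ A ∧ N.head e = v} := by
          refine sum_le_sum fun v _ => ?_
          unfold bump
          split_ifs <;> simp
      _ = N.crossing univ A := by
          unfold crossing
          rw [card_eq_sum_card_fiberwise (f := N.head) (t := Aᶜ)]
          · refine sum_congr rfl fun v hv => ?_
            congr 1
            ext e
            simp only [mem_filter, mem_univ, true_and]
            constructor
            · rintro ⟨h, rfl⟩; exact ⟨⟨h, by simpa using hv⟩, rfl⟩
            · rintro ⟨⟨h, -⟩, rfl⟩; exact ⟨h, rfl⟩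
          · intro e he
            simpa using (by simpa using he : N.tail e ∈ A ∧ N.head e ∉ A).2
  simp only [cut, Pi.add_apply, sum_add_distrib]
  omega

variable {N} {s t : V} {f : ℕ} {i : ℕ} {S : Finset V} {c : V → ℕ}

theorem Stage.supply_target (h : N.Stage s t f i S c) : c t = 0 := by
  induction h with
  | zero => rfl
  | succ _ _ _ ih => simp [ih, bump]

theorem Stage.source_mem (h : N.Stage s t f i S c) : s ∈ S := by
  induction h with
  | zero => simp
  | succ _ hA _ ih => exact hA.subset ih

theorem Stage.target_notMem (hst : s ≠ t) (h : N.Stage s t f i S c) : t ∉ S := by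
  cases h with
  | zero => simpa using hst.symm
  | succ _ hA _ => exact hA.target

/-- Each stage raises the capacity of the cut `X` by at least one. Here `X` is a set with an edge of
`K`, not into `t`, from each cut `X ∩ A'` to the part of `X` outside `A'`; the head of that edge
either lies inside the next farthest minimum cut, or has received a supply that the next
stage can use. -/
theorem Stage.le_crossing {K : Finset ι} {X A : Finset V} {j : ℕ} (h : N.Stage s t f i S c)
    (hA : N.IsFarthestMinCut t S c A) (hf : ∀ Y, s ∈ Y → t ∉ Y → f ≤ N.crossing univ Y)
    (hAK : ∀ e, N.tail e ∈ A → e ∈ K)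
    (hs : s ∈ X) (ht : t ∉ X)
    (hX : ∀ A' ⊆ A, s ∈ A' → ∃ e, N.tail e ∈ A' ∧ N.head e ∉ A' ∧ N.head e ≠ t ∧ N.head e ∈ X)
    (hj : N.cut univ c A + j ≤ N.cut K c (X ∪ A)) :
    f + i + j ≤ N.crossing K X := by
  induction h generalizing A j with
  | zero =>
    have h₁ := N.cut_submodular K 0 0 X A
    have h₂ : N.cut K 0 (X ∩ A) = N.cut univ 0 (X ∩ A) := by
      unfold cut
      rw [N.crossing_eq_univ (A := A) inter_subset_right fun e he _ => hAK e he]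
    have h₃ : N.cut K 0 A = N.cut univ 0 A := by
      unfold cut
      rw [N.crossing_eq_univ (A := A) Subset.rfl fun e he _ => hAK e he]
    have h₄ := hA.le (X ∩ A) (by simpa [hs] using hA.subset) (by simp [ht])
    have h₅ := hf A (by simpa using hA.subset) hA.target
    have h₆ : N.cut univ 0 A = N.crossing univ A := by simp [cut]
    have h₇ : N.cut K 0 X = N.crossing K X := by simp [cut]
    simp only [add_zero] at h₁
    omega
  | @succ i S B c hS hB hb ih =>
    have hBA := hA.subset
    suffices h : N.cut univ c B + (j + 1) ≤ N.cut K c (X ∪ B) by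
      have := ih hB (fun e he => hAK e (hBA he)) (fun A' hA' => hX A' (hA'.trans hBA)) h
      omega
    have h₁ := N.cut_submodular K c (N.bump t B) (X ∪ B) A
    have h₂ : N.cut K c ((X ∪ B) ∩ A) = N.cut univ c ((X ∪ B) ∩ A) := by
      unfold cut
      rw [N.crossing_eq_univ (A := A) inter_subset_right fun e he _ => hAK e he]
    have h₃ : N.cut K (c + N.bump t B) A = N.cut univ (c + N.bump t B) A := by
      unfold cut
      rw [N.crossing_eq_univ (A := A) Subset.rfl fun e he _ => hAK e he]
    have hu : X ∪ B ∪ A = X ∪ A := by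
      rw [union_assoc, union_eq_right.2 hBA]
    have hsub : S ⊆ (X ∪ B) ∩ A :=
      subset_inter (hB.subset.trans subset_union_right) (hB.subset.trans hBA)
    have htt : t ∉ (X ∪ B) ∩ A := fun h => hA.target (mem_inter.1 h).2
    have h₄ := hB.le _ hsub htt
    rw [hu] at h₁
    obtain ⟨e, he₁, he₂, he₃, he₄⟩ := hX B hBA (hB.subset hS.source_mem)
    by_cases hv : N.head e ∈ A
    · have : N.cut univ c ((X ∪ B) ∩ A) ≠ N.cut univ c B := fun h =>
        he₂ (hB.largest _ hsub htt h (by simp [he₄, hv]))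
      omega
    · have h₅ : N.bump t B (N.head e) ≤ ∑ v ∈ (X ∪ B) \ A, N.bump t B v :=
        single_le_sum (f := N.bump t B) (fun _ _ => Nat.zero_le _) (by simp [he₄, hv])
      have h₆ : 0 < N.bump t B (N.head e) := by
        rw [bump, if_neg he₃, card_pos]
        exact ⟨e, by simp [he₁]⟩
      omega

end Net

/-! ### Flows with supplies -/

namespace Net

open Finset

set_option linter.unusedSectionVars false

variable {V ι : Type*} [Fintype V] [DecidableEq V] [Fintype ι] [DecidableEq ι] (N : Net V ι)

/-- The net amount of the flow `g` that enters `v`. -/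
def inflow (g : ι → ℤ) (v : V) : ℤ := ∑ e with N.head e = v, g e - ∑ e with N.tail e = v, g e

/-- `g` is an integral flow of unit capacity from the sources `S` and the supplies `c` to `t`, where
`r` is the part of the supplies that is left. The flow has one unit too much at the vertex `x`; so
it is a flow in the usual sense for `x = t`. -/
structure IsFlowAt (t : V) (S : Finset V) (c r : V → ℕ) (g : ι → ℤ) (x : V) : Prop where
  zero_or_one : ∀ e, g e = 0 ∨ g e = 1
  tail_target : ∀ e, N.tail e = t → g e = 0
  rest_target : r t = 0
  rest_le : ∀ v, v ∉ S → r v ≤ c v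
  balance : ∀ v, v ∉ S → v ≠ t → N.inflow g v + c v = r v + if v = x then 1 else 0

variable {N} {t x : V} {S : Finset V} {c r : V → ℕ} {g : ι → ℤ}

theorem sum_inflow (g : ι → ℤ) (X : Finset V) :
    ∑ v ∈ X, N.inflow g v =
      ∑ e, ((if N.head e ∈ X then g e else 0) - if N.tail e ∈ X then g e else 0) := by
  simp only [inflow, sum_sub_distrib]
  congr 1 <;> simp only [sum_filter] <;> rw [sum_comm] <;>
    exact sum_congr rfl fun e _ => by simp

/-- The amount by which the capacity of a cut exceeds the value of a flow. -/
theorem IsFlowAt.cut_sub_inflow (h : N.IsFlowAt t S c r g t) (hc : c t = 0) {X : Finset V}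
    (hS : S ⊆ X) (ht : t ∉ X) :
    (N.cut univ c X : ℤ) - N.inflow g t =
      ∑ e with N.tail e ∈ X ∧ N.head e ∉ X, (1 - g e) +
        ∑ e with N.tail e ∉ X ∧ N.head e ∈ X, g e + ∑ v ∈ Xᶜ, (r v : ℤ) := by
  have h₁ : ∑ v ∈ Xᶜ, (N.inflow g v + c v - r v) = N.inflow g t := by
    rw [sum_eq_single_of_mem t (by simpa using ht)]
    · simp [hc, h.rest_target]
    · intro v hv hvt
      have := h.balance v (fun hvS => by simp at hv; exact hv (hS hvS)) hvt
      rw [if_neg hvt] at this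
      omega
  have h₂ := sum_inflow (N := N) g Xᶜ
  rw [sum_sub_distrib, sum_add_distrib, h₂] at h₁
  have h₃ : (N.crossing univ X : ℤ) = ∑ e, if N.tail e ∈ X ∧ N.head e ∉ X then 1 else 0 := by
    simp [crossing]
  rw [← h₁, cut, Nat.cast_add, h₃, sum_filter, sum_filter]
  have h₄ : ∑ e, (if N.tail e ∈ X ∧ N.head e ∉ X then (1 : ℤ) else 0)
      - ∑ e, ((if N.head e ∈ Xᶜ then g e else 0) - if N.tail e ∈ Xᶜ then g e else 0)
      = ∑ e, (if N.tail e ∈ X ∧ N.head e ∉ X then (1 - g e) else 0)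
        + ∑ e, (if N.tail e ∉ X ∧ N.head e ∈ X then g e else 0) := by
    rw [← sum_sub_distrib, ← sum_add_distrib]
    refine sum_congr rfl fun e _ => ?_
    by_cases h₁ : N.tail e ∈ X <;> by_cases h₂ : N.head e ∈ X <;> simp [h₁, h₂]
  push_cast
  linarith

theorem IsFlowAt.nonneg (h : N.IsFlowAt t S c r g x) (e : ι) : 0 ≤ g e ∧ g e ≤ 1 := by
  rcases h.zero_or_one e with h | h <;> simp [h]

/-- Weak duality, also for a set `K` of edges that contains all the edges with flow. -/
theorem IsFlowAt.inflow_le_cut (h : N.IsFlowAt t S c r g t) (hc : c t = 0) {K : Finset ι}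
    (hK : ∀ e, g e = 1 → e ∈ K) {X : Finset V} (hS : S ⊆ X) (ht : t ∉ X) :
    N.inflow g t ≤ N.cut K c X := by
  have h₁ := h.cut_sub_inflow hc hS ht
  have h₂ : (N.crossing univ X : ℤ) ≤
      N.crossing K X + ∑ e with N.tail e ∈ X ∧ N.head e ∉ X, (1 - g e) := by
    have h₃ : ∀ K : Finset ι, (N.crossing K X : ℤ) =
        ∑ e, if e ∈ K ∧ N.tail e ∈ X ∧ N.head e ∉ X then 1 else 0 := by
      intro K
      rw [crossing, card_filter]
      push_cast
      rw [← sum_filter, ← sum_filter]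
      simp only [sum_const]
      congr 2
      ext e
      simp
    rw [h₃, h₃, sum_filter, ← sum_add_distrib]
    refine sum_le_sum fun e _ => ?_
    by_cases he : e ∈ K
    · have := h.nonneg e
      by_cases h₁ : N.tail e ∈ X <;> by_cases h₂ : N.head e ∈ X <;> (simp [he, h₁, h₂]; try omega)
    · have : g e = 0 := (h.zero_or_one e).resolve_right fun h => he (hK e h)
      simp [he, this]
  have h₃ : 0 ≤ ∑ e with N.tail e ∉ X ∧ N.head e ∈ X, g e := sum_nonneg fun e _ => (h.nonneg e).1
  have h₄ : (0 : ℤ) ≤ ∑ v ∈ Xᶜ, (r v : ℤ) := sum_nonneg fun _ _ => by positivity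
  unfold cut at h₁ ⊢
  push_cast at h₁ ⊢
  linarith

/-- `B` is backward closed in the residual network of `g`. -/
def ResidualClosed (N : Net V ι) (g : ι → ℤ) (B : Finset V) : Prop :=
  (∀ e, N.head e ∈ B → g e = 0 → N.tail e ∈ B) ∧ ∀ e, N.tail e ∈ B → g e = 1 → N.head e ∈ B

/-- If the set `B` of the vertices that reach `t` in the residual network contains no source, then
its complement is the farthest minimum cut, and it is saturated. -/
theorem IsFlowAt.isFarthestMinCut (h : N.IsFlowAt t S c r g t) (hc : c t = 0) {B : Finset V}
    (ht : t ∈ B) (hB : N.ResidualClosed g B)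
    (hmin : ∀ Y, t ∈ Y → N.ResidualClosed g Y → B ⊆ Y) (hBS : Disjoint B S)
    (hr : ∀ v ∈ B, r v = 0) :
    N.IsFarthestMinCut t S c Bᶜ ∧ (N.cut univ c Bᶜ : ℤ) = N.inflow g t := by
  have hSB : S ⊆ Bᶜ := fun v hv => by
    simpa using fun hvB => (Finset.disjoint_left.1 hBS hvB hv)
  have heq : (N.cut univ c Bᶜ : ℤ) = N.inflow g t := by
    have h₁ := h.cut_sub_inflow hc hSB (by simpa using ht)
    rw [sum_eq_zero, sum_eq_zero, sum_eq_zero] at h₁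
    · simpa [sub_eq_zero] using h₁
    · intro v hv
      simpa using hr v (by simpa using hv)
    · intro e he
      simp only [mem_filter, mem_univ, true_and, mem_compl, not_not] at he
      exact (h.zero_or_one e).resolve_right fun h => he.2 (hB.2 e he.1 h)
    · intro e he
      simp only [mem_filter, mem_univ, true_and, mem_compl, not_not] at he
      have := (h.zero_or_one e).resolve_left fun h => he.1 (hB.1 e he.2 h)
      omega
  refine ⟨⟨hSB, by simpa using ht, fun X hX htX => ?_, fun X hX htX hXB => ?_⟩, heq⟩
  · have := h.inflow_le_cut hc (K := univ) (by simp) hX htX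
    omega
  · have h₁ := h.cut_sub_inflow hc hX htX
    have h₂ : 0 ≤ ∑ e with N.tail e ∈ X ∧ N.head e ∉ X, (1 - g e) :=
      sum_nonneg fun e _ => by have := h.nonneg e; omega
    have h₃ : 0 ≤ ∑ e with N.tail e ∉ X ∧ N.head e ∈ X, g e := sum_nonneg fun e _ => (h.nonneg e).1
    have h₄ : (0 : ℤ) ≤ ∑ v ∈ Xᶜ, (r v : ℤ) := sum_nonneg fun _ _ => by positivity
    have h₅ : ∑ e with N.tail e ∈ X ∧ N.head e ∉ X, (1 - g e) = 0 := by omega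
    have h₆ : ∑ e with N.tail e ∉ X ∧ N.head e ∈ X, g e = 0 := by omega
    rw [sum_eq_zero_iff_of_nonneg fun e _ => by have := h.nonneg e; omega] at h₅
    rw [sum_eq_zero_iff_of_nonneg fun e _ => (h.nonneg e).1] at h₆
    have hcl : N.ResidualClosed g Xᶜ := by
      constructor
      · intro e he hg
        by_contra hX
        have := h₅ e (by simpa using ⟨by simpa using hX, by simpa using he⟩)
        omega
      · intro e he hg
        by_contra hX
        have := h₆ e (by simpa using ⟨by simpa using he, by simpa using hX⟩)
        omega
    have := hmin Xᶜ (by simpa using htX) hcl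
    intro v hv
    simp only [mem_compl]
    exact fun hvB => by simpa [hv] using this hvB

theorem inflow_update (g : ι → ℤ) (e : ι) (a : ℤ) (v : V) :
    N.inflow (Function.update g e a) v = N.inflow g v +
      ((if N.head e = v then a - g e else 0) - if N.tail e = v then a - g e else 0) := by
  have key : ∀ p : ι → Prop, ∀ [DecidablePred p], ∑ e' with p e', Function.update g e a e' =
      ∑ e' with p e', g e' + if p e then a - g e else 0 := by
    intro p _
    have h₁ : ∀ e', Function.update g e a e' = g e' + if e' = e then a - g e else 0 := by
      intro e'
      by_cases h : e' = e
      · subst h; simp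
      · simp [h]
    simp only [h₁, sum_add_distrib, sum_ite_eq', mem_filter, mem_univ, true_and]
  unfold inflow
  rw [key (fun e => N.head e = v), key (fun e => N.tail e = v)]
  ring

/-- Moving the excess from the tail of an empty edge to its head. -/
theorem IsFlowAt.push {e : ι} (h : N.IsFlowAt t S c r g (N.tail e)) (hx : N.tail e ≠ t)
    (he : g e = 0) : N.IsFlowAt t S c r (Function.update g e 1) (N.head e) := by
  refine ⟨fun e' => ?_, fun e' he' => ?_, h.rest_target, h.rest_le, fun v hv hvt => ?_⟩
  · by_cases h' : e' = e
    · subst h'; simp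
    · simpa [h'] using h.zero_or_one e'
  · have h' : e' ≠ e := fun h => hx (h ▸ he')
    simpa [h'] using h.tail_target e' he'
  · have := h.balance v hv hvt
    rw [inflow_update]
    simp only [he, eq_comm (a := v)] at this ⊢
    split_ifs at this ⊢ <;> omega

/-- Moving the excess from the head of a full edge to its tail. -/
theorem IsFlowAt.pull {e : ι} (h : N.IsFlowAt t S c r g (N.head e)) (he : g e = 1) :
    N.IsFlowAt t S c r (Function.update g e 0) (N.tail e) := by
  refine ⟨fun e' => ?_, fun e' he' => ?_, h.rest_target, h.rest_le, fun v hv hvt => ?_⟩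
  · by_cases h' : e' = e
    · subst h'; simp
    · simpa [h'] using h.zero_or_one e'
  · by_cases h' : e' = e
    · subst h'; simp
    · simpa [h'] using h.tail_target e' he'
  · have := h.balance v hv hvt
    rw [inflow_update]
    simp only [he, eq_comm (a := v)] at this ⊢
    split_ifs at this ⊢ <;> omega

/-- Drawing one unit at a source, or from the supply that is left at `x`, creates an excess. -/
theorem IsFlowAt.draw (h : N.IsFlowAt t S c r g t) (hx : x ≠ t) (hxr : x ∈ S ∨ r x ≠ 0) :
    N.IsFlowAt t S c (Function.update r x (r x - 1)) g x := by
  refine ⟨h.zero_or_one, h.tail_target, by simpa [hx.symm] using h.rest_target, fun v hv => ?_,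
    fun v hv hvt => ?_⟩
  · have := h.rest_le v hv
    by_cases hvx : v = x
    · subst hvx
      simp only [Function.update_self]
      omega
    · simpa [hvx] using this
  have := h.balance v hv hvt
  by_cases hvx : v = x
  · subst hvx
    have := hxr.resolve_left hv
    simp only [Function.update_self, if_true]
    rw [if_neg hvt] at *
    omega
  · simpa [hvx, hvt] using this

/-- A flow stays a flow if sources and supplies are added. -/
theorem IsFlowAt.enlarge (h : N.IsFlowAt t S c r g t) {S' : Finset V} (hS : S ⊆ S')
    {b r' : V → ℕ} (hr : ∀ v, v ∉ S' → v ≠ t → r' v = r v + b v) (ht : r' t = 0) :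
    N.IsFlowAt t S' (c + b) r' g t := by
  refine ⟨h.zero_or_one, h.tail_target, ht, fun v hv => ?_, fun v hv hvt => ?_⟩
  · by_cases hvt : v = t
    · simp [hvt, ht]
    · rw [hr v hv hvt]
      exact Nat.add_le_add_right (h.rest_le v fun h => hv (hS h)) _
  have := h.balance v (fun h => hv (hS h)) hvt
  rw [hr v hv hvt]
  simp only [Pi.add_apply]
  push_cast
  omega

/-- Without flow out of `t`, the value of a flow is the number of edges into `t` that carry flow. -/
theorem IsFlowAt.inflow_target (h : N.IsFlowAt t S c r g x) :
    N.inflow g t = #{e | N.head e = t ∧ g e = 1} := by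
  have h₁ : ∑ e with N.tail e = t, g e = 0 :=
    sum_eq_zero fun e he => h.tail_target e (by simpa using he)
  rw [inflow, h₁, sub_zero, card_filter, sum_filter]
  push_cast
  refine sum_congr rfl fun e _ => ?_
  rcases h.zero_or_one e with he | he <;> simp [he]

theorem isFlowAt_zero (s t : V) : N.IsFlowAt t {s} 0 0 0 t :=
  ⟨fun _ => .inl rfl, fun _ _ => rfl, rfl, fun _ _ => le_rfl, fun v _ hv => by simp [inflow, hv]⟩

end Net

/-! ### Digraphs as networks -/

namespace Net

open Finset

set_option linter.unusedSectionVars false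

variable {V ι : Type*} [Fintype V] [DecidableEq V] [Fintype ι] [DecidableEq ι] (N : Net V ι)

/-- The edges of the digraph `G` are those of the network with an index in `K`, and the network has
no parallel edges. -/
structure Represents (K : Finset ι) (G : Digraph V) : Prop where
  injective : Function.Injective fun e => (N.tail e, N.head e)
  adj_iff : ∀ u v, G.Adj u v ↔ ∃ e ∈ K, N.tail e = u ∧ N.head e = v

variable {N} {G H : Digraph V} {s t : V} {f : ℕ} {K : Finset ι}

/-- Weak duality for real flows. -/
theorem Represents.flowValue_le (hN : N.Represents univ G) {φ : V → V → ℝ} (hφ : IsFlow G s t φ)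
    {X : Finset V} (hs : s ∈ X) (ht : t ∉ X) : flowValue s φ ≤ N.crossing univ X := by
  have h₁ : flowValue s φ = ∑ v ∈ X, (∑ w, φ v w - ∑ u, φ u v) := by
    rw [sum_eq_single_of_mem s hs]
    · rfl
    · intro v hv hvs
      rw [hφ.conserved v hvs (fun h => ht (h ▸ hv)), sub_self]
  have h₂ : ∑ v ∈ X, (∑ w, φ v w - ∑ u, φ u v) =
      ∑ v ∈ X, ∑ w ∈ Xᶜ, φ v w - ∑ v ∈ X, ∑ u ∈ Xᶜ, φ u v := by
    simp only [sum_sub_distrib, ← sum_add_sum_compl X, sum_add_distrib]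
    rw [sum_comm (s := X) (t := X)]
    ring
  have h₃ : 0 ≤ ∑ v ∈ X, ∑ u ∈ Xᶜ, φ u v :=
    sum_nonneg fun v _ => sum_nonneg fun u _ => hφ.nonneg u v
  have h₄ : ∑ v ∈ X, ∑ w ∈ Xᶜ, φ v w ≤ N.crossing univ X := by
    classical
    have h₅ : ∀ v w, φ v w ≤ #{e | N.tail e = v ∧ N.head e = w} := by
      intro v w
      by_cases h : G.Adj v w
      · obtain ⟨e, -, he⟩ := (hN.adj_iff v w).1 h
        have : 1 ≤ #{e | N.tail e = v ∧ N.head e = w} := card_pos.2 ⟨e, by simpa using he⟩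
        exact (hφ.le_one v w).trans (by exact_mod_cast this)
      · rw [hφ.supported v w h]
        positivity
    calc ∑ v ∈ X, ∑ w ∈ Xᶜ, φ v w
        ≤ ∑ v ∈ X, ∑ w ∈ Xᶜ, (#{e | N.tail e = v ∧ N.head e = w} : ℝ) :=
          sum_le_sum fun v _ => sum_le_sum fun w _ => h₅ v w
      _ = N.crossing univ X := by
          rw [← sum_product', crossing,
            card_eq_sum_card_fiberwise (f := fun e => (N.tail e, N.head e)) (t := X ×ˢ Xᶜ)]
          · push_cast
            refine sum_congr rfl fun p hp => ?_
            congr 2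
            ext e
            simp only [mem_filter, mem_univ, true_and, Prod.ext_iff]
            simp only [mem_product, mem_compl] at hp
            constructor
            · rintro ⟨h₁, h₂⟩; exact ⟨by rw [h₁, h₂]; exact hp, h₁, h₂⟩
            · exact fun h => h.2
          · intro e he
            simpa using he
  linarith

/-- An integral flow from `s` to `t` is a real flow. -/
theorem Represents.exists_isFlow (hN : N.Represents univ G) {r : V → ℕ} {g : ι → ℤ} (hst : s ≠ t)
    (hg : N.IsFlowAt t {s} 0 r g t) :
    ∃ φ, IsFlow G s t φ ∧ flowValue s φ = ((N.inflow g t : ℤ) : ℝ) := by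
  have hin : ∀ v, ∑ u, ∑ e with N.tail e = u ∧ N.head e = v, (g e : ℝ) =
      ∑ e with N.head e = v, (g e : ℝ) := by
    intro v
    simp only [sum_filter, ite_and]
    rw [sum_comm]
    exact sum_congr rfl fun e _ => by simp
  have hout : ∀ v, ∑ w, ∑ e with N.tail e = v ∧ N.head e = w, (g e : ℝ) =
      ∑ e with N.tail e = v, (g e : ℝ) := by
    intro v
    simp only [sum_filter, ite_and]
    rw [sum_comm]
    exact sum_congr rfl fun e _ => by by_cases h : N.tail e = v <;> simp [h]
  have hbal : ∀ v, v ≠ s → v ≠ t → N.inflow g v = 0 := by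
    intro v hvs hvt
    have h₁ := hg.balance v (by simpa using hvs) hvt
    have h₂ := hg.rest_le v (by simpa using hvs)
    simp only [Pi.zero_apply, hvt, if_false] at h₁ h₂
    omega
  refine ⟨fun u v => ∑ e with N.tail e = u ∧ N.head e = v, (g e : ℝ), ⟨fun u v => ?_, fun u v => ?_,
    fun u v huv => ?_, fun v hvs hvt => ?_⟩, ?_⟩
  · exact sum_nonneg fun e _ => by exact_mod_cast (hg.nonneg e).1
  · have : #{e | N.tail e = u ∧ N.head e = v} ≤ 1 := by
      refine card_le_one.2 fun a ha b hb => hN.injective ?_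
      simp only [mem_filter, mem_univ, true_and] at ha hb
      simp [ha, hb]
    calc ∑ e with N.tail e = u ∧ N.head e = v, (g e : ℝ)
        ≤ ∑ e with N.tail e = u ∧ N.head e = v, (1 : ℝ) :=
          sum_le_sum fun e _ => by exact_mod_cast (hg.nonneg e).2
      _ ≤ 1 := by simpa using this
  · refine sum_eq_zero fun e he => absurd ((hN.adj_iff u v).2 ⟨e, mem_univ e, ?_⟩) huv
    simpa using he
  · rw [hin, hout]
    have := hbal v hvs hvt
    rw [inflow, sub_eq_zero] at this
    exact_mod_cast this
  · have htot : ∑ v, N.inflow g v = 0 := by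
      rw [sum_inflow]
      simp
    have h₁ : ∑ v, N.inflow g v = N.inflow g s + N.inflow g t := by
      rw [← sum_subset (subset_univ {s, t}), sum_pair hst]
      intro v _ hv
      simp only [mem_insert, mem_singleton, not_or] at hv
      exact hbal v hv.1 hv.2
    have h₂ : N.inflow g t = ∑ e with N.tail e = s, g e - ∑ e with N.head e = s, g e := by
      rw [h₁] at htot
      have : N.inflow g s = ∑ e with N.head e = s, g e - ∑ e with N.tail e = s, g e := rfl
      omega
    unfold flowValue
    rw [hin, hout, h₂]
    push_cast
    rfl

/-- The values of flows at most double from stage to stage. In the beginning they are bounded by the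
value of a real maximum flow, later by the capacity of the previous farthest minimum cut. -/
theorem Represents.inflow_le (hN : N.Represents univ G) (hst : s ≠ t)
    (hf : IsMaxFlowValue G s t f) {i : ℕ} {S : Finset V} {c r : V → ℕ} {g : ι → ℤ}
    (hS : N.Stage s t f i S c) (hg : N.IsFlowAt t S c r g t) : N.inflow g t ≤ 2 ^ i * f := by
  cases hS with
  | zero =>
    obtain ⟨φ, hφ, hv⟩ := hN.exists_isFlow hst hg
    have := hf.2 ⟨φ, hφ, hv⟩
    simpa using (by exact_mod_cast this : N.inflow g t ≤ f)
  | @succ i S' _ c hS hA hb =>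
    have h₁ := hg.inflow_le_cut (hS.succ hA hb).supply_target (K := univ) (by simp)
      Subset.rfl hA.target
    have h₂ := N.cut_bump_le t c S
    have h₃ : N.cut univ (c + N.bump t S) S ≤ 2 ^ (i + 1) * f := by
      rw [pow_succ]
      linarith
    exact h₁.trans (by exact_mod_cast h₃)

theorem Represents.le_crossing (hN : N.Represents univ G) (hf : IsMaxFlowValue G s t f)
    {X : Finset V} (hs : s ∈ X) (ht : t ∉ X) : f ≤ N.crossing univ X := by
  obtain ⟨φ, hφ, hv⟩ := hf.1
  have := hN.flowValue_le hφ hs ht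
  rw [hv] at this
  exact_mod_cast this

/-- The edges into `t` with flow, for a maximum flow of the last stage, together with all the edges
that do not enter `t`, form a fault-tolerant reachability subgraph. -/
theorem Represents.isFTRS (hN : N.Represents univ G) (hH : N.Represents K H)
    (hf : IsMaxFlowValue G s t f) (hf₀ : 1 ≤ f) {i : ℕ} {S A : Finset V} {c r : V → ℕ} {g : ι → ℤ}
    (hS : N.Stage s t f i S c) (hg : N.IsFlowAt t S c r g t)
    (hA : N.IsFarthestMinCut t S c A) (hcut : (N.cut univ c A : ℤ) = N.inflow g t)
    (hK : ∀ e, e ∈ K ↔ N.head e ≠ t ∨ g e = 1) : IsFTRS G s (i + f - 1) H := by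
  classical
  have hHG : ∀ u v, H.Adj u v → G.Adj u v := by
    intro u v h
    obtain ⟨e, -, he⟩ := (hH.adj_iff u v).1 h
    exact (hN.adj_iff u v).2 ⟨e, mem_univ e, he⟩
  -- The maximum flow saturates the cut `A`.
  have hAK : ∀ e, N.tail e ∈ A → e ∈ K := by
    intro e he
    rw [hK]
    by_contra! hcon
    have h₁ := hg.cut_sub_inflow hS.supply_target hA.subset hA.target
    have h₂ : 1 - g e ≤ ∑ e with N.tail e ∈ A ∧ N.head e ∉ A, (1 - g e) :=
      single_le_sum (f := fun e => 1 - g e) (fun e _ => by have := hg.nonneg e; simp; omega)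
        (by simp [he, hcon.1, hA.target])
    have h₃ : 0 ≤ ∑ e with N.tail e ∉ A ∧ N.head e ∈ A, g e :=
      sum_nonneg fun e _ => (hg.nonneg e).1
    have h₄ : (0 : ℤ) ≤ ∑ v ∈ Aᶜ, (r v : ℤ) := sum_nonneg fun _ _ => by positivity
    have := hg.zero_or_one e
    omega
  refine ⟨fun u v => hHG u v, fun F hF hFcard => ?_⟩
  set X : Finset V := {v | Reachable (deleteEdges H F) s v} with hX
  have hsX : s ∈ X := by
    simp only [hX, mem_filter, mem_univ, true_and]
    exact Relation.ReflTransGen.refl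
  have hstep : ∀ e ∈ K, N.tail e ∈ X → (N.tail e, N.head e) ∉ F → N.head e ∈ X := by
    intro e he hu hF
    simp only [hX, mem_filter, mem_univ, true_and] at hu ⊢
    exact Relation.ReflTransGen.tail hu ⟨(hH.adj_iff _ _).2 ⟨e, he, rfl, rfl⟩, hF⟩
  have ht : Reachable (deleteEdges G F) s t → t ∈ X := by
    intro hreach
    by_contra htX
    have hex : ∀ A' ⊆ A, s ∈ A' →
        ∃ e, N.tail e ∈ A' ∧ N.head e ∉ A' ∧ N.head e ≠ t ∧ N.head e ∈ X := by
      intro A' hA' hsA'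
      -- The path to `t` that is left in `G` leaves the set `A' ∩ X`.
      obtain ⟨u, v, ⟨huv, huvF⟩, hu, hv⟩ : ∃ u v, (deleteEdges G F).Adj u v ∧
          u ∈ A' ∩ X ∧ v ∉ A' ∩ X := by
        by_contra! hcon
        have : ∀ v, Reachable (deleteEdges G F) s v → v ∈ A' ∩ X := by
          intro v hv
          induction hv with
          | refl => exact mem_inter.2 ⟨hsA', hsX⟩
          | tail _ h ih => exact hcon _ _ h ih
        exact htX (mem_inter.1 (this t hreach)).2
      obtain ⟨e, -, rfl, rfl⟩ := (hN.adj_iff u v).1 huv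
      obtain ⟨huA, huX⟩ := mem_inter.1 hu
      have hvX := hstep e (hAK e (hA' huA)) huX huvF
      exact ⟨e, huA, fun h => hv (mem_inter.2 ⟨h, hvX⟩), fun h => htX (h ▸ hvX), hvX⟩
    have h₁ := hS.le_crossing (K := K) (X := X) (j := 0) hA (fun Y => hN.le_crossing hf) hAK hsX
      htX hex (by
        have := hg.inflow_le_cut hS.supply_target (K := K) (X := X ∪ A)
          (fun e he => (hK e).2 (.inr he)) (hA.subset.trans subset_union_right)
          (by simp [htX, hA.target])
        omega)
    have h₂ : N.crossing K X ≤ F.card := by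
      refine card_le_card_of_injOn (fun e => (N.tail e, N.head e)) (fun e he => ?_)
        hN.injective.injOn
      simp only [coe_filter, Set.mem_ofPred_eq] at he
      by_contra hF
      exact he.2.2 (hstep e he.1 he.2.1 hF)
    omega
  intro v
  constructor
  · exact fun h => Relation.ReflTransGen.mono (fun u v h => ⟨hHG u v h.1, h.2⟩) _ _ h
  · intro h
    suffices v ∈ X by simpa [hX] using this
    induction h with
    | refl => exact hsX
    | @tail u v hu huv ih =>
      obtain ⟨e, -, rfl, rfl⟩ := (hN.adj_iff u v).1 huv.1
      by_cases hv : N.head e = t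
      · exact hv ▸ ht (hv ▸ hu.tail huv)
      · exact hstep e ((hK e).2 (.inl hv)) ih huv.2

end Net

section HalfEdges

/-! ### Half-edges, incidence lists and the residual search -/

/-- A half-edge: the tail end `(e, false)` or the head end `(e, true)` of the edge `e`. -/
abbrev HalfEdge (m : ℕ) := Fin m × Bool

namespace HalfEdge

variable {m : ℕ}

/-- Half-edges are numbered from one, so that zero can mark the end of a list. -/
def code (x : HalfEdge m) : ℕ := 2 * x.1 + 1 + x.2.toNat

/-- The other end of the same edge. -/
def opp (x : HalfEdge m) : HalfEdge m := (x.1, !x.2)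

/-- The number of an optional half-edge. -/
def optCode : Option (HalfEdge m) → ℕ
  | none => 0
  | some x => x.code

@[simp] theorem optCode_some (x : HalfEdge m) : optCode (some x) = x.code := rfl

@[simp] theorem opp_false (e : Fin m) : opp (e, false) = (e, true) := rfl

@[simp] theorem opp_true (e : Fin m) : opp (e, true) = (e, false) := rfl

@[simp] theorem code_false (e : Fin m) : code (e, false) = 2 * e + 1 := rfl

@[simp] theorem code_true (e : Fin m) : code (e, true) = 2 * e + 1 + 1 := rfl

theorem code_injective : Function.Injective (code (m := m)) := by
  rintro ⟨e, a⟩ ⟨e', a'⟩ h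
  cases a <;> cases a' <;> simp [code] at h <;> simp <;> omega

@[simp] theorem code_inj {x y : HalfEdge m} : x.code = y.code ↔ x = y := code_injective.eq_iff

theorem code_ne_zero (x : HalfEdge m) : x.code ≠ 0 := by
  simp [code]

end HalfEdge

open HalfEdge

variable {n m : ℕ}

/-- The vertex at which a half-edge sits. -/
def Net.site (N : Net (Fin n) (Fin m)) (x : HalfEdge m) : Fin n :=
  if x.2 then N.head x.1 else N.tail x.1

@[simp] theorem Net.site_true (N : Net (Fin n) (Fin m)) (e : Fin m) :
    N.site (e, true) = N.head e := rfl

@[simp] theorem Net.site_false (N : Net (Fin n) (Fin m)) (e : Fin m) :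
    N.site (e, false) = N.tail e := rfl

/-- The lists with first elements `fs` and successors `nx` enumerate, for each vertex, the
half-edges in `D` that sit there. That they enumerate all of them is expressed by induction:
a set that contains the first one and is closed under `nx` contains them all. -/
structure IsIncidence (N : Net (Fin n) (Fin m)) (D : Set (HalfEdge m))
    (nx : HalfEdge m → Option (HalfEdge m)) (fs : Fin n → Option (HalfEdge m)) : Prop where
  nx_outside : ∀ x, x ∉ D → nx x = none
  nx_site : ∀ x y, nx x = some y → N.site y = N.site x
  fs_site : ∀ v y, fs v = some y → N.site y = v
  fs_isSome : ∀ x ∈ D, ∃ y, fs (N.site x) = some y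
  cover : ∀ Y : Set (HalfEdge m), (∀ x ∈ Y, ∀ y, nx x = some y → y ∈ Y) →
    ∀ x ∈ D, ∀ y, fs (N.site x) = some y → y ∈ Y → x ∈ Y

theorem isIncidence_empty (N : Net (Fin n) (Fin m)) :
    IsIncidence N ∅ (fun _ => none) (fun _ => none) :=
  ⟨by simp, by simp, by simp, by simp, by simp⟩

theorem IsIncidence.insert {N : Net (Fin n) (Fin m)} {D : Set (HalfEdge m)}
    {nx : HalfEdge m → Option (HalfEdge m)} {fs : Fin n → Option (HalfEdge m)}
    (h : IsIncidence N D nx fs) {y : HalfEdge m} (hy : y ∉ D) :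
    IsIncidence N (insert y D) (Function.update nx y (fs (N.site y)))
      (Function.update fs (N.site y) (some y)) := by
  refine ⟨fun x hx => ?_, fun x z hz => ?_, fun v z hz => ?_, fun x hx => ?_,
    fun Y hY x hx z hz hzY => ?_⟩
  · simp only [Set.mem_insert_iff, not_or] at hx
    simpa [hx.1] using h.nx_outside x hx.2
  · by_cases hxy : x = y
    · subst hxy
      simp only [Function.update_self] at hz
      exact h.fs_site _ _ hz
    · simp only [Function.update_of_ne hxy] at hz
      exact h.nx_site _ _ hz
  · by_cases hv : v = N.site y
    · subst hv
      simp only [Function.update_self, Option.some.injEq] at hz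
      rw [hz]
    · simp only [Function.update_of_ne hv] at hz
      exact h.fs_site _ _ hz
  · by_cases hv : N.site x = N.site y
    · exact ⟨y, by simp [hv]⟩
    · rcases hx with rfl | hx
      · exact absurd rfl hv
      · obtain ⟨z, hz⟩ := h.fs_isSome x hx
        exact ⟨z, by simpa [hv] using hz⟩
  · have hY' : ∀ x ∈ Y, ∀ z, nx x = some z → z ∈ Y := by
      intro x hx z hz
      by_cases hxy : x = y
      · rw [hxy, h.nx_outside y hy] at hz
        simp at hz
      · exact hY x hx z (by simpa [hxy] using hz)
    by_cases hv : N.site x = N.site y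
    · simp only [hv, Function.update_self, Option.some.injEq] at hz
      subst hz
      rcases hx with rfl | hx
      · exact hzY
      · obtain ⟨w, hw⟩ := h.fs_isSome x hx
        exact h.cover Y hY' x hx w hw (hY _ hzY w (by simpa [← hv] using hw))
    · rw [Function.update_of_ne hv] at hz
      rcases hx with rfl | hx
      · exact absurd rfl hv
      · exact h.cover Y hY' x hx z hz hzY

section Search

variable (N : Net (Fin n) (Fin m)) (nx : HalfEdge m → Option (HalfEdge m))
  (fs : Fin n → Option (HalfEdge m)) (t : Fin n) (ρ : ℕ → ℕ)

/-- A vertex has been reached when the first element of its incidence list is in the queue. -/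
def Seen (q : List (HalfEdge m)) (v : Fin n) : Prop := ∃ y, fs v = some y ∧ y ∈ q

/-- The half-edges `q` in the queue of a backward search from `t`. The search passes from a
half-edge `x` to the other end of its edge if `ρ x.code ≠ 0`; `via` stores, for each vertex
reached, the number of the half-edge that led there, and the rank decreases along these. -/
structure SearchTree (via : ℕ → ℕ) (q : List (HalfEdge m)) : Prop where
  nodup : q.Nodup
  root : Seen fs q t
  minimal : ∀ Y : Finset (Fin n), t ∈ Y →
    (∀ x, N.site x ∈ Y → ρ x.code ≠ 0 → N.site x.opp ∈ Y) → ∀ x ∈ q, N.site x ∈ Y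
  seen : ∀ x ∈ q, Seen fs q (N.site x)
  parent : ∃ rank : Fin n → ℕ, (∀ v, Seen fs q v → rank v < q.length) ∧
    ∀ v, v ≠ t → Seen fs q v → ∃ x : HalfEdge m, via v = x.code ∧ N.site x.opp = v ∧
      ρ x.code ≠ 0 ∧ Seen fs q (N.site x) ∧ rank (N.site x) < rank v

variable {N nx fs t ρ} {via : ℕ → ℕ} {q : List (HalfEdge m)}

theorem Seen.append {v : Fin n} (h : Seen fs q v) (y : HalfEdge m) : Seen fs (q ++ [y]) v := by
  obtain ⟨z, hz, hq⟩ := h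
  exact ⟨z, hz, by simp [hq]⟩

theorem seen_append_iff {v : Fin n} {y : HalfEdge m} :
    Seen fs (q ++ [y]) v ↔ Seen fs q v ∨ fs v = some y := by
  constructor
  · rintro ⟨z, hz, hq⟩
    rcases List.mem_append.1 hq with h | h
    · exact .inl ⟨z, hz, h⟩
    · exact .inr (by rw [hz, List.mem_singleton.1 h])
  · rintro (h | h)
    · exact h.append y
    · exact ⟨y, h, by simp⟩

theorem SearchTree.length_le (h : SearchTree N fs t ρ via q) : q.length ≤ 2 * m := by
  have := h.nodup.length_le_card
  simpa [mul_comm] using this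

theorem SearchTree.seen_next_iff {D : Set (HalfEdge m)} (h : SearchTree N fs t ρ via q)
    (hI : IsIncidence N D nx fs) {x y : HalfEdge m} (hx : x ∈ q) (hxy : nx x = some y)
    (hy : y ∉ q) (v : Fin n) : Seen fs (q ++ [y]) v ↔ Seen fs q v := by
  rw [seen_append_iff]
  refine ⟨fun h' => h'.elim id fun hv => ?_, .inl⟩
  obtain ⟨z, hz, hzq⟩ := h.seen x hx
  rw [← hI.nx_site x y hxy, hI.fs_site v y hv, hv, Option.some.injEq] at hz
  exact absurd (hz ▸ hzq) hy

theorem SearchTree.push_next {D : Set (HalfEdge m)} (h : SearchTree N fs t ρ via q)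
    (hI : IsIncidence N D nx fs) {x y : HalfEdge m} (hx : x ∈ q) (hxy : nx x = some y)
    (hy : y ∉ q) : SearchTree N fs t ρ via (q ++ [y]) := by
  have hseen := h.seen_next_iff hI hx hxy hy
  refine ⟨?_, (hseen t).2 h.root, fun Y ht hY z hz => ?_, fun z hz => ?_, ?_⟩
  · exact h.nodup.append (List.nodup_singleton y) (by simpa using hy)
  · rcases List.mem_append.1 hz with hz | hz
    · exact h.minimal Y ht hY z hz
    · rw [List.mem_singleton.1 hz, hI.nx_site x y hxy]
      exact h.minimal Y ht hY x hx
  · rw [hseen]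
    rcases List.mem_append.1 hz with hz | hz
    · exact h.seen z hz
    · rw [List.mem_singleton.1 hz, hI.nx_site x y hxy]
      exact h.seen x hx
  · obtain ⟨rank, h₁, h₂⟩ := h.parent
    simp only [hseen]
    exact ⟨rank, fun v hv => by have := h₁ v hv; simp; omega, h₂⟩

theorem SearchTree.push_arc {D : Set (HalfEdge m)} (h : SearchTree N fs t ρ via q)
    (hI : IsIncidence N D nx fs) {x y : HalfEdge m} (hx : x ∈ q) (hρ : ρ x.code ≠ 0)
    (hxy : fs (N.site x.opp) = some y) (hy : y ∉ q) :
    SearchTree N fs t ρ (Function.update via (N.site x.opp) x.code) (q ++ [y]) := by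
  have hyv := hI.fs_site _ _ hxy
  have hnew : ¬ Seen fs q (N.site x.opp) := by
    rintro ⟨z, hz, hzq⟩
    rw [hxy, Option.some.injEq] at hz
    exact hy (hz ▸ hzq)
  have hseen : ∀ v, Seen fs (q ++ [y]) v ↔ Seen fs q v ∨ v = N.site x.opp := by
    intro v
    rw [seen_append_iff]
    refine or_congr_right ⟨fun hv => ?_, fun hv => hv ▸ hxy⟩
    rw [← hI.fs_site v y hv, hyv]
  refine ⟨?_, h.root.append y, fun Y ht hY z hz => ?_, fun z hz => ?_, ?_⟩
  · exact h.nodup.append (List.nodup_singleton y) (by simpa using hy)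
  · rcases List.mem_append.1 hz with hz | hz
    · exact h.minimal Y ht hY z hz
    · rw [List.mem_singleton.1 hz, hyv]
      exact hY x (h.minimal Y ht hY x hx) hρ
  · rcases List.mem_append.1 hz with hz | hz
    · exact (h.seen z hz).append y
    · rw [List.mem_singleton.1 hz, hyv]
      exact (hseen _).2 (.inr rfl)
  · obtain ⟨rank, h₁, h₂⟩ := h.parent
    have hne : ∀ v, Seen fs q v → v ≠ N.site x.opp := fun v hv h => hnew (h ▸ hv)
    refine ⟨Function.update rank (N.site x.opp) q.length, fun v hv => ?_, fun v hvt hv => ?_⟩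
    · rcases (hseen v).1 hv with hv | hv
      · have := h₁ v hv
        simp [hne v hv]
        omega
      · simp [hv]
    · rcases (hseen v).1 hv with hv | hv
      · obtain ⟨z, hz₁, hz₂, hz₃, hz₄, hz₅⟩ := h₂ v hvt hv
        refine ⟨z, ?_, hz₂, hz₃, hz₄.append y, ?_⟩
        · rw [Function.update_of_ne (fun h => hne v hv (Fin.ext h)), hz₁]
        · simpa [hne v hv, hne _ hz₄] using hz₅
      · subst hv
        have hxs := h.seen x hx
        exact ⟨x, by simp, rfl, hρ, hxs.append y, by simpa [hne _ hxs] using h₁ _ hxs⟩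

end Search

/-- `ρ` stores the residual capacities of the flow `g`: a search may pass from the tail end of an
edge to its head if the edge carries flow, and from its head to its tail if it does not. -/
def IsResidual (ρ : ℕ → ℕ) (g : Fin m → ℤ) : Prop :=
  ∀ e : Fin m, (ρ (code (e, false)) : ℤ) = g e ∧ (ρ (code (e, true)) : ℤ) = 1 - g e

section Residual

variable {N : Net (Fin n) (Fin m)} {ρ : ℕ → ℕ} {g : Fin m → ℤ} {t : Fin n} {S : Finset (Fin n)}
  {c r : Fin n → ℕ}

/-- The flow after the residual capacity at the half-edge `x` has been used. -/
def useArc (g : Fin m → ℤ) (x : HalfEdge m) : Fin m → ℤ :=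
  Function.update g x.1 (if x.2 then 1 else 0)

theorem IsResidual.useArc (h : IsResidual ρ g) (x : HalfEdge m) :
    IsResidual (Function.update (Function.update ρ x.code 0) x.opp.code 1) (useArc g x) := by
  intro e
  obtain ⟨e', b⟩ := x
  have := h e
  by_cases he : e = e'
  · subst he
    cases b
    · constructor <;> simp [FTReach.useArc]
    · constructor <;> simp [FTReach.useArc]
  · have h₁ : ∀ a a', code (e, a) ≠ code (e', a') := fun a a' h => by
      have := code_injective h
      simp only [Prod.mk.injEq] at this
      exact he this.1
    simpa only [FTReach.useArc, opp, Function.update_of_ne (h₁ _ _), Function.update_of_ne he]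
      using this

theorem IsResidual.isFlowAt_useArc (h : IsResidual ρ g) {x : HalfEdge m}
    (hg : N.IsFlowAt t S c r g (N.site x.opp)) (hx : ρ x.code ≠ 0) (ht : N.site x.opp ≠ t) :
    N.IsFlowAt t S c r (FTReach.useArc g x) (N.site x) := by
  obtain ⟨e, b⟩ := x
  have := h e
  have h₁ := hg.zero_or_one e
  cases b
  · have he : g e = 1 := by omega
    exact hg.pull he
  · have he : g e = 0 := by omega
    exact hg.push ht he

theorem IsResidual.inflow_useArc (h : IsResidual ρ g) {x : HalfEdge m}
    (hg : N.IsFlowAt t S c r g (N.site x.opp)) (hx : ρ x.code ≠ 0) (ht : N.site x.opp ≠ t) :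
    N.inflow (FTReach.useArc g x) t = N.inflow g t + if N.site x = t then 1 else 0 := by
  obtain ⟨e, b⟩ := x
  have h₀ := h e
  have h₁ := hg.zero_or_one e
  unfold FTReach.useArc
  rw [Net.inflow_update]
  cases b
  · have : g e = 1 := by omega
    simp only [opp_false, Net.site_true, Net.site_false] at ht ⊢
    simp only [this, ht, if_false]
    split_ifs <;> simp_all
  · have : g e = 0 := by omega
    simp only [opp_true, Net.site_true, Net.site_false] at ht ⊢
    simp only [this, ht, if_false]
    split_ifs <;> simp_all

end Residual

end HalfEdges

section SearchProgram

open HalfEdge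

/-! ### The search and its correctness -/

infixr:65 " ;; " => Code.seq

/-- A term that vanishes exactly when the two variables are equal. -/
def Term.distinct (v w : Var) : Term := ((Term.var v).sub (.var w)).add ((Term.var w).sub (.var v))

/-- A term that vanishes exactly when the half-edge with number `succ` has been marked. -/
def Term.unmarked : Term := (Term.var .stamp).sub (.get .mark (.var .succ))

/-- Mark the half-edge `succ` and append it to the queue. -/
def enqueue : Code :=
  .store .mark (.var .succ) (.var .stamp) ;;
  .store .queue (.var .queueTail) (.var .succ) ;;
  .assign .queueTail ((Term.var .queueTail).add (.lit 1))

/-- Start a search: only the first half-edge at the target is in the queue. -/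
def searchInit : Code :=
  .assign .stamp ((Term.var .stamp).add (.lit 1)) ;;
  .assign .queueHead (.lit 0) ;;
  .assign .queueTail (.lit 0) ;;
  .assign .found (.lit 0) ;;
  .assign .succ (.get .first (.var .target)) ;;
  enqueue

/-- Take the next half-edge from the queue and pass to its successor in the incidence list. -/
def searchNext : Code :=
  .assign .node (.get .queue (.var .queueHead)) ;;
  .assign .queueHead ((Term.var .queueHead).add (.lit 1)) ;;
  .assign .succ (.get .next (.var .node)) ;;
  .cond (.var .succ) (.cond .unmarked enqueue .skip) .skip

/-- Pass to the other end of the edge if the residual capacity permits it, and test whether there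
is a source. -/
def searchArc : Code :=
  .cond (.get .residual (.var .node))
    (.assign .vertex (.get .site (.get .partner (.var .node))) ;;
      .assign .succ (.get .first (.var .vertex)) ;;
      .cond .unmarked
        (enqueue ;;
          .store .via (.var .vertex) (.var .node) ;;
          .cond ((Term.get .inSource (.var .vertex)).add (.get .supply (.var .vertex)))
            (.assign .found (.lit 1) ;; .assign .walker (.var .vertex)) .skip) .skip) .skip

/-- The condition that the queue is not exhausted. -/
def queueNonempty : Term := (Term.var .queueTail).sub (.var .queueHead)

/-- A search from the target, backwards through the residual network. -/
def search : Prog :=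
  .seq searchInit.compile (.loop queueNonempty.compile (searchNext ;; searchArc).compile)

variable {n m : ℕ} (N : Net (Fin n) (Fin m)) (nx : HalfEdge m → Option (HalfEdge m))
  (fs : Fin n → Option (HalfEdge m)) (t : Fin n)

/-- The parts of the memory that stay fixed after the setup: the graph and the target, and the
output, which is still empty. -/
structure Stores (h : View) : Prop where
  site : ∀ x : HalfEdge m, h.arr .site x.code = N.site x
  partner : ∀ x : HalfEdge m, h.arr .partner x.code = x.opp.code
  next : ∀ x : HalfEdge m, h.arr .next x.code = optCode (nx x)
  first : ∀ v : Fin n, h.arr .first v = optCode (fs v)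
  edgeCount : h.var .edgeCount = m
  target : h.var .target = t
  out : h.out = []

/-- The parts of the memory that a search leaves unchanged. -/
structure Frame (ρ α β : ℕ → ℕ) (j : ℕ) (h : View) : Prop extends Stores N nx fs t h where
  residual : h.arr .residual = ρ
  inSource : h.arr .inSource = α
  supply : h.arr .supply = β
  stages : h.var .stages = j

/-- The state of a search with queue `q`, when the successors in the incidence lists have been
visited for the first `i` entries of the queue, and the other ends for the first `j`. -/
structure SearchState (ρ α β : ℕ → ℕ) (st : ℕ) (q : List (HalfEdge m)) (i j : ℕ)
    (h : View) : Prop where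
  tree : SearchTree N fs t ρ (h.arr .via) q
  stamp : h.var .stamp = st
  queueTail : h.var .queueTail = q.length
  queue : ∀ k (hk : k < q.length), h.arr .queue k = q[k].code
  mark_le : ∀ x : HalfEdge m, h.arr .mark x.code ≤ st
  mark_iff : ∀ x : HalfEdge m, h.arr .mark x.code = st ↔ x ∈ q
  next_closed : ∀ k (hk : k < q.length), k < i → ∀ y, nx q[k] = some y → y ∈ q
  arc_closed : ∀ k (hk : k < q.length), k < j → ρ q[k].code ≠ 0 →
    ∀ y, fs (N.site q[k].opp) = some y → y ∈ q
  found : h.var .found ≠ 0 → ∃ u : Fin n, h.var .walker = u ∧ u ≠ t ∧ Seen fs q u ∧ α u + β u ≠ 0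
  not_found : h.var .found = 0 → ∀ u, u ≠ t → Seen fs q u → α u + β u = 0

variable {N nx fs t} {ρ α β : ℕ → ℕ} {J st : ℕ} {q : List (HalfEdge m)} {I : List ℕ}

theorem Stores.congr {h h' : View} (hF : Stores N nx fs t h)
    (ha : ∀ a ∈ [Arr.site, .partner, .next, .first], h'.arr a = h.arr a)
    (hv : ∀ v ∈ [Var.edgeCount, .target], h'.var v = h.var v) (ho : h'.out = h.out) :
    Stores N nx fs t h' where
  site x := by rw [ha .site (by simp), hF.site]
  partner x := by rw [ha .partner (by simp), hF.partner]
  next x := by rw [ha .next (by simp), hF.next]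
  first v := by rw [ha .first (by simp), hF.first]
  edgeCount := by rw [hv .edgeCount (by simp), hF.edgeCount]
  target := by rw [hv .target (by simp), hF.target]
  out := by rw [ho, hF.out]

theorem Frame.congr {h h' : View} (hF : Frame N nx fs t ρ α β J h)
    (ha : ∀ a ∈ [Arr.site, .partner, .next, .first, .residual, .inSource, .supply],
      h'.arr a = h.arr a)
    (hv : ∀ v ∈ [Var.edgeCount, .target, .stages], h'.var v = h.var v) (ho : h'.out = h.out) :
    Frame N nx fs t ρ α β J h' where
  toStores := hF.toStores.congr (fun a h => ha a (by simp at h ⊢; tauto))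
    (fun v h => hv v (by simp at h ⊢; tauto)) ho
  residual := by rw [ha .residual (by simp), hF.residual]
  inSource := by rw [ha .inSource (by simp), hF.inSource]
  supply := by rw [ha .supply (by simp), hF.supply]
  stages := by rw [hv .stages (by simp), hF.stages]

/-- The effect of `enqueue` on the state of a search. -/
theorem SearchState.push {h h' : View} {i j i' j' : ℕ} {y : HalfEdge m}
    (hS : SearchState N nx fs t ρ α β st q i j h)
    (hmark : h'.arr .mark = Function.update (h.arr .mark) y.code st)
    (hqueue : h'.arr .queue = Function.update (h.arr .queue) q.length y.code)
    (htail : h'.var .queueTail = q.length + 1) (hstamp : h'.var .stamp = st)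
    (htree : SearchTree N fs t ρ (h'.arr .via) (q ++ [y]))
    (hi : i' ≤ q.length) (hj : j' ≤ q.length)
    (hnext : ∀ k (hk : k < q.length), k < i' → i ≤ k → ∀ z, nx q[k] = some z → z ∈ q ++ [y])
    (harc : ∀ k (hk : k < q.length), k < j' → j ≤ k → ρ q[k].code ≠ 0 →
      ∀ z, fs (N.site q[k].opp) = some z → z ∈ q ++ [y])
    (hfound : h'.var .found ≠ 0 →
      ∃ u : Fin n, h'.var .walker = u ∧ u ≠ t ∧ Seen fs (q ++ [y]) u ∧ α u + β u ≠ 0)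
    (hnot : h'.var .found = 0 → ∀ u, u ≠ t → Seen fs (q ++ [y]) u → α u + β u = 0) :
    SearchState N nx fs t ρ α β st (q ++ [y]) i' j' h' := by
  refine ⟨htree, hstamp, by simpa using htail, fun k hk => ?_, fun x => ?_, fun x => ?_,
    fun k hk hki z hz => ?_, fun k hk hkj hρ z hz => ?_, hfound, hnot⟩
  · rw [hqueue]
    by_cases hkq : k < q.length
    · rw [Function.update_of_ne hkq.ne, List.getElem_append_left hkq, hS.queue k hkq]
    · have : k = q.length := by simp at hk; omega
      subst this
      simp
  · rw [hmark]
    by_cases hx : x = y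
    · subst hx; simp
    · rw [Function.update_of_ne (by simpa using hx)]
      exact hS.mark_le x
  · rw [hmark]
    by_cases hx : x = y
    · subst hx; simp
    · rw [Function.update_of_ne (by simpa using hx), hS.mark_iff]
      simp [hx]
  · have hkq : k < q.length := by omega
    rw [List.getElem_append_left hkq] at hz
    by_cases h : k < i
    · exact List.mem_append_left _ (hS.next_closed k hkq h z hz)
    · exact hnext k hkq hki (by omega) z hz
  · have hkq : k < q.length := by omega
    rw [List.getElem_append_left hkq] at hz hρ
    by_cases h : k < j
    · exact List.mem_append_left _ (hS.arc_closed k hkq h hρ z hz)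
    · exact harc k hkq hkj (by omega) hρ z hz

/-- A step of a search that adds nothing to the queue. -/
theorem SearchState.stay {h h' : View} {i j i' j' : ℕ}
    (hS : SearchState N nx fs t ρ α β st q i j h)
    (ha : ∀ a ∈ [Arr.via, .queue, .mark], h'.arr a = h.arr a)
    (hv : ∀ v ∈ [Var.stamp, .queueTail, .found, .walker], h'.var v = h.var v)
    (hnext : ∀ k (hk : k < q.length), k < i' → i ≤ k → ∀ z, nx q[k] = some z → z ∈ q)
    (harc : ∀ k (hk : k < q.length), k < j' → j ≤ k → ρ q[k].code ≠ 0 →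
      ∀ z, fs (N.site q[k].opp) = some z → z ∈ q) :
    SearchState N nx fs t ρ α β st q i' j' h' := by
  refine ⟨?_, ?_, ?_, fun k hk => ?_, fun x => ?_, fun x => ?_,
    fun k hk hki z hz => ?_, fun k hk hkj hρ z hz => ?_, ?_, ?_⟩
  · rw [ha .via (by simp)]; exact hS.tree
  · rw [hv .stamp (by simp), hS.stamp]
  · rw [hv .queueTail (by simp), hS.queueTail]
  · rw [ha .queue (by simp), hS.queue k hk]
  · rw [ha .mark (by simp)]; exact hS.mark_le x
  · rw [ha .mark (by simp)]; exact hS.mark_iff x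
  · by_cases h : k < i
    · exact hS.next_closed k hk h z hz
    · exact hnext k hk hki (by omega) z hz
  · by_cases h : k < j
    · exact hS.arc_closed k hk h hρ z hz
    · exact harc k hk hkj (by omega) hρ z hz
  · rw [hv .found (by simp), hv .walker (by simp)]; exact hS.found
  · rw [hv .found (by simp)]; exact hS.not_found

theorem searchInit_wp (hI : IsIncidence N Set.univ nx fs) (ht : ∃ y, fs t = some y) {h : View}
    (hF : Frame N nx fs t ρ α β J h)
    (hm : ∀ x : HalfEdge m, h.arr .mark x.code ≤ h.var .stamp) :
    searchInit.wp I (fun h' => h'.var .queueHead = 0 ∧ Frame N nx fs t ρ α β J h' ∧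
      ∃ q, SearchState N nx fs t ρ α β (h.var .stamp + 1) q 0 0 h') h := by
  obtain ⟨y, hy⟩ := ht
  have hys := hI.fs_site _ _ hy
  simp only [searchInit, enqueue, Code.wp, Term.Safe, Term.eval, true_and, and_true]
  refine ⟨by simp, ?_, [y], ?_⟩
  · exact hF.congr (by simp) (by simp) (by simp)
  · have hf : h.arr .first (h.var .target) = y.code := by rw [hF.target, hF.first, hy]; rfl
    have hseen : ∀ v, Seen fs [y] v → v = t := by
      rintro v ⟨z, hz, hzy⟩
      rw [List.mem_singleton.1 hzy] at hz
      rw [← hys, hI.fs_site _ _ hz]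
    constructor
    · refine ⟨by simp, ⟨y, hy, by simp⟩, fun Y hY _ x hx => ?_, fun x hx => ?_, fun _ => 0,
        fun _ _ => by simp, fun v hv hs => absurd (hseen v hs) hv⟩
      · rw [List.mem_singleton.1 hx, hys]; exact hY
      · rw [List.mem_singleton.1 hx, hys]; exact ⟨y, hy, by simp⟩
    · simp
    · simp
    · intro k hk
      have : k = 0 := by simpa using hk
      subst this
      simp [hf]
    · intro x
      by_cases hx : x = y
      · subst hx; simp [hf]
      · simpa [hf, hx] using (hm x).trans (Nat.le_succ _)
    · intro x
      by_cases hx : x = y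
      · subst hx; simp [hf]
      · simpa [hf, hx] using ((hm x).trans_lt (Nat.lt_succ_self _)).ne
    · simp
    · simp
    · simp
    · simpa using fun u hu hs => absurd (hseen u hs) hu

/-- The test whether a half-edge has been marked. -/
theorem SearchState.unmarked_iff {h : View} {i j : ℕ} (hS : SearchState N nx fs t ρ α β st q i j h)
    (x : HalfEdge m) : st - h.arr .mark x.code ≠ 0 ↔ x ∉ q := by
  have h₁ := hS.mark_le x
  rw [← hS.mark_iff]
  omega

theorem searchNext_wp (hI : IsIncidence N Set.univ nx fs) {h : View} {i : ℕ}
    (hF : Frame N nx fs t ρ α β J h) (hS : SearchState N nx fs t ρ α β st q i i h)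
    (hi : h.var .queueHead = i) (hiq : i < q.length) :
    searchNext.wp I (fun h' => h'.var .queueHead = i + 1 ∧ h'.var .node = q[i].code ∧
      Frame N nx fs t ρ α β J h' ∧
      ∃ q', q <+: q' ∧ SearchState N nx fs t ρ α β st q' (i + 1) i h') h := by
  have hq := hS.queue i hiq
  have hn := hF.next q[i]
  simp only [searchNext, enqueue, Code.wp, Term.Safe, Term.eval, true_and, and_true, Term.unmarked,
    View.setVar_var_self, View.setVar_arr, View.setArr_var, ne_eq, reduceCtorEq,
    not_false_eq_true, View.setVar_var_of_ne, hi, hq, hn, hS.stamp,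
    hS.queueTail]
  rcases hnx : nx q[i] with _ | y
  · refine ⟨fun h => absurd rfl h, fun _ => ⟨hF.congr (by simp) (by simp) (by simp), q,
      List.prefix_rfl, hS.stay (by simp) (by simp) (fun k hk hki hik z hz => ?_)
      fun k _ _ _ => by omega⟩⟩
    obtain rfl : k = i := by omega
    simp [hnx] at hz
  · refine ⟨fun _ => ⟨fun hu => ?_, fun hu => ⟨hF.congr (by simp) (by simp) (by simp), q,
      List.prefix_rfl, hS.stay (by simp) (by simp) (fun k hk hki hik z hz => ?_)
      fun k _ _ _ => by omega⟩⟩, fun h => absurd h y.code_ne_zero⟩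
    · have hyq := (hS.unmarked_iff y).1 hu
      have hx : q[i] ∈ q := List.getElem_mem hiq
      have hseen := hS.tree.seen_next_iff hI hx hnx hyq
      refine ⟨hF.congr (by simp) (by simp) (by simp), q ++ [y], List.prefix_append _ _,
        hS.push (by simp [optCode]) (by simp [optCode]) (by simp) (by simpa using hS.stamp)
          (by simpa using hS.tree.push_next hI hx hnx hyq) hiq hiq.le
          (fun k hk hki hik z hz => ?_) (fun k _ _ _ => by omega) ?_ ?_⟩
      · obtain rfl : k = i := by omega
        rw [hnx, Option.some.injEq] at hz
        simp [hz]
      · simpa [hseen] using hS.found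
      · simpa [hseen] using hS.not_found
    · obtain rfl : k = i := by omega
      rw [hnx, Option.some.injEq] at hz
      subst hz
      by_contra hyq
      exact (hS.unmarked_iff y).2 hyq hu

theorem searchArc_wp (hI : IsIncidence N Set.univ nx fs) {h : View} {i : ℕ}
    (hF : Frame N nx fs t ρ α β J h) (hS : SearchState N nx fs t ρ α β st q (i + 1) i h)
    (hiq : i < q.length) (hnode : h.var .node = q[i].code) :
    searchArc.wp I (fun h' => h'.var .queueHead = h.var .queueHead ∧
      Frame N nx fs t ρ α β J h' ∧
      ∃ q', q <+: q' ∧ SearchState N nx fs t ρ α β st q' (i + 1) (i + 1) h') h := by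
  have hp := hF.partner q[i]
  have hs := hF.site q[i].opp
  have hf := hF.first (N.site q[i].opp)
  obtain ⟨y, hy⟩ := hI.fs_isSome q[i].opp (Set.mem_univ _)
  rw [hy] at hf
  simp only [searchArc, enqueue, Code.wp, Term.Safe, Term.eval, true_and, and_true, Term.unmarked,
    View.setVar_var_self, View.setVar_arr, View.setArr_var, ne_eq, reduceCtorEq,
    not_false_eq_true, View.setVar_var_of_ne, View.setArr_arr_of_ne, hp, hs, hf, hnode, hS.stamp,
    hS.queueTail, hF.residual, hF.inSource, hF.supply, optCode]
  refine ⟨fun hρ => ⟨fun hu => ?_, fun hu => ⟨hF.congr (by simp) (by simp) (by simp), q,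
      List.prefix_rfl, hS.stay (by simp) (by simp) (fun k hk hki hik => by omega)
      fun k hk hki hik _ z hz => ?_⟩⟩, fun hρ => ⟨hF, q, List.prefix_rfl, hS.stay (by simp)
      (by simp) (fun k hk hki hik => by omega) fun k hk hki hik h => ?_⟩⟩
  · have hyq := (hS.unmarked_iff y).1 hu
    have hx : q[i] ∈ q := List.getElem_mem hiq
    have hseen : ∀ v, Seen fs (q ++ [y]) v ↔ Seen fs q v ∨ v = N.site q[i].opp := by
      intro v
      rw [seen_append_iff]
      refine or_congr_right ⟨fun hv => ?_, fun hv => hv ▸ hy⟩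
      rw [← hI.fs_site v y hv, hI.fs_site _ y hy]
    have hnt : N.site q[i].opp ≠ t := by
      intro h
      obtain ⟨z, hz, hzq⟩ := hS.tree.root
      rw [← h, hy, Option.some.injEq] at hz
      exact hyq (hz ▸ hzq)
    have htree := hS.tree.push_arc hI hx hρ hy hyq
    have harc : ∀ k (hk : k < q.length), k < i + 1 → i ≤ k → ρ q[k].code ≠ 0 →
        ∀ z, fs (N.site q[k].opp) = some z → z ∈ q ++ [y] := by
      intro k hk hki hik _ z hz
      obtain rfl : k = i := by omega
      rw [hy, Option.some.injEq] at hz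
      simp [hz]
    refine ⟨fun hsrc => ⟨hF.congr (by simp) (by simp) (by simp), q ++ [y],
      List.prefix_append _ _, ?_⟩, fun hsrc => ⟨hF.congr (by simp) (by simp) (by simp), q ++ [y],
      List.prefix_append _ _, ?_⟩⟩
    · refine hS.push (by simp) (by simp) (by simp) (by simpa using hS.stamp) (by simpa using htree)
        hiq hiq (fun k _ _ _ => by omega) harc (fun _ => ?_) (by simp)
      exact ⟨N.site q[i].opp, by simp, hnt, (hseen _).2 (.inr rfl), hsrc⟩
    · refine hS.push (by simp) (by simp) (by simp) (by simpa using hS.stamp) (by simpa using htree)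
        hiq hiq (fun k _ _ _ => by omega) harc (fun h => ?_) (fun h u hut hu => ?_)
      · obtain ⟨u, h₁, h₂, h₃, h₄⟩ := hS.found (by simpa using h)
        exact ⟨u, by simpa using h₁, h₂, h₃.append y, h₄⟩
      · rcases (hseen u).1 hu with hu | rfl
        · exact hS.not_found (by simpa using h) u hut hu
        · exact hsrc
  · obtain rfl : k = i := by omega
    rw [hy, Option.some.injEq] at hz
    subst hz
    by_contra hyq
    exact (hS.unmarked_iff y).2 hyq hu
  · obtain rfl : k = i := by omega
    exact absurd hρ h

/-- A bound for the number of steps of a search: a constant for each half-edge. -/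
def searchCost (m : ℕ) : ℕ :=
  searchInit.cost + (2 * m * (queueNonempty.compile.cost + 1 + (searchNext ;; searchArc).cost) +
    (queueNonempty.compile.cost + 1))

theorem search_triple (hI : IsIncidence N Set.univ nx fs) (ht : ∃ y, fs t = some y) {h : View}
    (hF : Frame N nx fs t ρ α β J h)
    (hm : ∀ x : HalfEdge m, h.arr .mark x.code ≤ h.var .stamp) :
    Triple I h search (searchCost m) fun h' => Frame N nx fs t ρ α β J h' ∧
      ∃ q, SearchState N nx fs t ρ α β (h.var .stamp + 1) q q.length q.length h' := by
  refine (Code.triple _ (searchInit_wp hI ht hF hm)).seq fun h₁ hh₁ => ?_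
  obtain ⟨h₂, h₃, q, h₄⟩ := hh₁
  refine Triple.loop (J := fun b h' => ∃ q i, Frame N nx fs t ρ α β J h' ∧
      SearchState N nx fs t ρ α β (h.var .stamp + 1) q i i h' ∧ h'.var .queueHead = i ∧
      i ≤ q.length ∧ b + i = 2 * m) (fun b h' _ => by simp [queueNonempty, Term.Safe])
    ?_ ?_ (2 * m) h₁ ⟨q, 0, h₃, h₄, h₂, Nat.zero_le _, rfl⟩
  · rintro b h' ⟨q, i, hF, hS, hi, hiq, hb⟩ hne
    have hlt : i < q.length := by
      simp only [queueNonempty, Term.eval, hS.queueTail, hi] at hne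
      omega
    refine Code.triple (searchNext ;; searchArc)
      (Code.wp_mono searchNext (searchNext_wp hI hF hS hi hlt) ?_)
    rintro h₁ ⟨hi₁, hn₁, hF₁, q₁, hq₁, hS₁⟩
    have hlt₁ : i < q₁.length := hlt.trans_le hq₁.length_le
    have hget : q₁[i] = q[i] := (hq₁.getElem hlt).symm
    refine Code.wp_mono _ (searchArc_wp hI hF₁ hS₁ hlt₁ (by rw [hn₁, hget])) ?_
    rintro h₂ ⟨hi₂, hF₂, q₂, hq₂, hS₂⟩
    have := hS₁.tree.length_le
    have := hq₂.length_le
    exact ⟨b - 1, by omega, q₂, i + 1, hF₂, hS₂, by rw [hi₂, hi₁], by omega, by omega⟩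
  · rintro b h' ⟨q, i, hF, hS, hi, hiq, hb⟩ h0
    have : i = q.length := by
      simp only [queueNonempty, Term.eval, hS.queueTail, hi] at h0
      omega
    exact ⟨hF, q, this ▸ hS⟩

end SearchProgram

section Rounds

open HalfEdge

/-! ### Augmentation -/

/-- Use up one unit of the supply at the walker. At a source this has no significance. -/
def draw : Code :=
  .store .supply (.var .walker) ((Term.get .supply (.var .walker)).sub (.lit 1))

/-- Move the walker along one edge of the augmenting path. -/
def walkStep : Code :=
  .assign .node (.get .via (.var .walker)) ;;
  .store .residual (.var .node) (.lit 0) ;;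
  .store .residual (.get .partner (.var .node)) (.lit 1) ;;
  .assign .walker (.get .site (.var .node))

/-- Send one unit of flow from the walker to the target. -/
def augment : Prog :=
  .seq draw.compile (.loop (Term.distinct .walker .target).compile walkStep.compile)

theorem Term.distinct_eval {I : List ℕ} {h : View} {v w : Var} :
    (Term.distinct v w).eval I h ≠ 0 ↔ h.var v ≠ h.var w := by
  simp only [Term.distinct, Term.eval]
  omega

theorem Term.distinct_safe {I : List ℕ} {h : View} {v w : Var} :
    (Term.distinct v w).Safe I h := by
  simp [Term.distinct, Term.Safe]

variable {n m : ℕ} {N : Net (Fin n) (Fin m)} {nx : HalfEdge m → Option (HalfEdge m)}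
  {fs : Fin n → Option (HalfEdge m)} {s t : Fin n} {ρ α β : ℕ → ℕ} {J st : ℕ}
  {q : List (HalfEdge m)} {I : List ℕ} {S : Finset (Fin n)} {c r : Fin n → ℕ} {g : Fin m → ℤ}

/-- A bound for the number of steps of an augmentation. -/
def augmentCost (m : ℕ) : ℕ :=
  draw.cost + (2 * m * ((Term.distinct .walker .target).compile.cost + 1 + walkStep.cost) +
    ((Term.distinct .walker .target).compile.cost + 1))

/-- The invariant of the walk: the excess of the flow is at the walker, and the edges through which
the vertices of lower rank were reached still have their residual capacity. -/
structure WalkState (N : Net (Fin n) (Fin m)) (fs : Fin n → Option (HalfEdge m)) (t : Fin n)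
    (S : Finset (Fin n)) (c r : Fin n → ℕ) (q : List (HalfEdge m)) (rank : Fin n → ℕ) (u : Fin n)
    (g : Fin m → ℤ) (h : View) : Prop where
  walker : h.var .walker = u
  seen : Seen fs q u
  flow : N.IsFlowAt t S c r g u
  residual : IsResidual (h.arr .residual) g
  path : ∀ v, v ≠ t → Seen fs q v → rank v ≤ rank u → ∃ x : HalfEdge m, h.arr .via v = x.code ∧
    N.site x.opp = v ∧ h.arr .residual x.code ≠ 0 ∧ Seen fs q (N.site x) ∧
    rank (N.site x) < rank v

theorem walkStep_wp {rank : Fin n → ℕ} {u : Fin n} {h : View} (hF : Stores N nx fs t h)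
    (hW : WalkState N fs t S c r q rank u g h) (hut : u ≠ t) :
    walkStep.wp I (fun h' => Stores N nx fs t h' ∧
      h'.arr .mark = h.arr .mark ∧ h'.var .stamp = h.var .stamp ∧
      h'.var .stages = h.var .stages ∧ h'.arr .inSource = h.arr .inSource ∧
      h'.arr .supply = h.arr .supply ∧
      ∃ u' g', WalkState N fs t S c r q rank u' g' h' ∧ rank u' < rank u ∧
        N.inflow g' t = N.inflow g t + if u' = t then 1 else 0) h := by
  obtain ⟨x, hx₁, hx₂, hx₃, hx₄, hx₅⟩ := hW.path u hut hW.seen le_rfl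
  have hg : N.IsFlowAt t S c r g (N.site x.opp) := hx₂ ▸ hW.flow
  have ht : N.site x.opp ≠ t := hx₂ ▸ hut
  simp only [walkStep, Code.wp, Term.Safe, Term.eval, true_and, View.setVar_var_self,
    View.setVar_arr, View.setArr_var, ne_eq, reduceCtorEq, not_false_eq_true,
    View.setArr_arr_of_ne, hW.walker, hx₁, hF.partner, hF.site]
  refine ⟨hF.congr (by simp) (by simp) (by simp), by simp, by simp,
    N.site x, useArc g x, ⟨by simp, hx₄, hW.residual.isFlowAt_useArc hg hx₃ ht, ?_, ?_⟩, hx₅,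
    hW.residual.inflow_useArc hg hx₃ ht⟩
  · simpa using hW.residual.useArc x
  · intro v hv hs hr
    obtain ⟨y, hy₁, hy₂, hy₃, hy₄, hy₅⟩ := hW.path v hv hs (hr.trans hx₅.le)
    refine ⟨y, by simpa using hy₁, hy₂, ?_, hy₄, hy₅⟩
    have hyx : y ≠ x := by
      rintro rfl
      rw [← hx₂, hy₂] at hx₅
      omega
    simp only [View.setVar_arr, View.setArr_arr_self]
    by_cases h : y = x.opp
    · simp [h]
    · rw [Function.update_of_ne (by simpa using h), Function.update_of_ne (by simpa using hyx)]
      exact hy₃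

theorem augment_triple {h : View} {u : Fin n} (hF : Stores N nx fs t h)
    (htree : SearchTree N fs t (h.arr .residual) (h.arr .via) q) (hu : h.var .walker = u)
    (hut : u ≠ t) (hseen : Seen fs q u) (hg : N.IsFlowAt t S c (fun v => h.arr .supply v) g t)
    (hres : IsResidual (h.arr .residual) g) (hsrc : u ∈ S ∨ h.arr .supply u ≠ 0) :
    Triple I h augment (augmentCost m) fun h' => Stores N nx fs t h' ∧
      h'.arr .mark = h.arr .mark ∧ h'.var .stamp = h.var .stamp ∧
      h'.var .stages = h.var .stages ∧ h'.arr .inSource = h.arr .inSource ∧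
      ∃ g', N.IsFlowAt t S c (fun v => h'.arr .supply v) g' t ∧
        IsResidual (h'.arr .residual) g' ∧ N.inflow g' t = N.inflow g t + 1 := by
  obtain ⟨rank, hr₁, hr₂⟩ := htree.parent
  set h₀ : View := h.setArr .supply u (h.arr .supply u - 1) with hh₀
  have hdraw : (fun v : Fin n => h₀.arr .supply v) =
      Function.update (fun v : Fin n => h.arr .supply v) u (h.arr .supply u - 1) := by
    funext v
    by_cases hv : v = u
    · subst hv; simp [hh₀]
    · have : (v : ℕ) ≠ u := fun h => hv (Fin.ext h)
      simp [hh₀, hv, this]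
  have hflow := hg.draw hut hsrc
  rw [← hdraw] at hflow
  refine (Code.triple (Q := fun h' => h' = h₀) draw ?_).seq ?_
  · simp [draw, Code.wp, Term.Safe, Term.eval, hu, hh₀]
  rintro _ rfl
  have hlen := htree.length_le
  have hru := hr₁ u hseen
  refine Triple.weaken (Triple.loop (T := walkStep.cost)
    (J := fun b h' => Stores N nx fs t h' ∧ h'.arr .mark = h.arr .mark ∧
      h'.var .stamp = h.var .stamp ∧ h'.var .stages = h.var .stages ∧
      h'.arr .inSource = h.arr .inSource ∧ h'.arr .supply = h₀.arr .supply ∧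
      ∃ u' g', WalkState N fs t S c (fun v => h₀.arr .supply v) q rank u' g' h' ∧ rank u' = b ∧
        N.inflow g' t = N.inflow g t + if u' = t then 1 else 0)
    (Q := fun h' => Stores N nx fs t h' ∧ h'.arr .mark = h.arr .mark ∧
      h'.var .stamp = h.var .stamp ∧ h'.var .stages = h.var .stages ∧
      h'.arr .inSource = h.arr .inSource ∧
      ∃ g', N.IsFlowAt t S c (fun v => h'.arr .supply v) g' t ∧
        IsResidual (h'.arr .residual) g' ∧ N.inflow g' t = N.inflow g t + 1)
    (fun b h' _ => Term.distinct_safe) ?_ ?_ (rank u) h₀ ?_) ?_ (fun _ h => h)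
  · rintro b h' ⟨h₁, h₂, h₃, h₄, h₅, h₆, u', g', hW, hb, hv⟩ hne
    have hut' : u' ≠ t := by
      rw [Term.distinct_eval, hW.walker, h₁.target] at hne
      exact fun h => hne (h ▸ rfl)
    refine (Code.triple _ (walkStep_wp h₁ hW hut')).weaken le_rfl ?_
    rintro h'' ⟨k₁, k₂, k₃, k₄, k₅, k₆, u'', g'', hW', hlt, hv'⟩
    rw [if_neg hut', add_zero] at hv
    exact ⟨_, hb ▸ hlt, k₁, k₂.trans h₂, k₃.trans h₃, k₄.trans h₄, k₅.trans h₅, k₆.trans h₆,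
      u'', g'', hW', rfl, hv ▸ hv'⟩
  · rintro b h' ⟨h₁, h₂, h₃, h₄, h₅, h₆, u', g', hW, hb, hv⟩ h0
    have hut' : u' = t := by
      have := mt (Term.distinct_eval (I := I) (h := h') (v := .walker) (w := .target)).2
        (not_not.2 h0)
      rw [not_not, hW.walker, h₁.target] at this
      exact Fin.ext this
    subst hut'
    exact ⟨h₁, h₂, h₃, h₄, h₅, g', h₆ ▸ hW.flow, hW.residual, by simpa using hv⟩
  · refine ⟨hF.congr (by simp [hh₀]) (by simp [hh₀]) (by simp [hh₀]), by simp [hh₀],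
      by simp [hh₀], by simp [hh₀], by simp [hh₀], rfl, u, g, ⟨by simpa [hh₀] using hu, hseen,
      hflow, by simpa [hh₀] using hres, fun v hv hs _ => ?_⟩, rfl, by simp [hut]⟩
    obtain ⟨x, hx⟩ := hr₂ v hv hs
    exact ⟨x, by simpa [hh₀] using hx⟩
  · gcongr
    omega

/-! ### The transition to the next stage -/

/-- Prepare a loop over the edges. -/
def scanInit : Code := .assign .counter (.lit 0) ;; .assign .cursor (.lit 1)

/-- Pass to the next edge in a loop over the edges. -/
def scanNext : Code :=
  .assign .counter ((Term.var .counter).add (.lit 1)) ;;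
  .assign .cursor ((Term.var .cursor).add (.lit 2))

/-- The condition of a loop over the edges. -/
def scanMore : Term := (Term.var .edgeCount).sub (.var .counter)

/-- Fetch the ends of the current edge. -/
def fetch : Code :=
  .assign .tail (.get .site (.var .cursor)) ;;
  .assign .head (.get .site ((Term.var .cursor).add (.lit 1)))

/-- The ends of the edge that the search has not reached become sources. If the search has
reached the head, but not the tail, then the head gets one more unit of supply. -/
def advanceStep : Code :=
  fetch ;;
  .assign .succ (.get .first (.var .head)) ;;
  .cond .unmarked (.store .inSource (.var .head) (.lit 1) ;; .assign .node (.lit 0))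
    (.assign .node (.distinct .head .target)) ;;
  .assign .succ (.get .first (.var .tail)) ;;
  .cond .unmarked (.store .inSource (.var .tail) (.lit 1) ;;
    .cond (.var .node)
      (.store .supply (.var .head) ((Term.get .supply (.var .head)).add (.lit 1))) .skip) .skip ;;
  scanNext

/-- Pass to the next stage. -/
def advance : Prog :=
  .seq (scanInit ;; .assign .stages ((Term.var .stages).sub (.lit 1))).compile
    (.loop scanMore.compile advanceStep.compile)

/-- A bound for the number of steps of a transition. -/
def advanceCost (m : ℕ) : ℕ :=
  (scanInit ;; .assign .stages ((Term.var .stages).sub (.lit 1))).cost +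
    (m * (scanMore.compile.cost + 1 + advanceStep.cost) + (scanMore.compile.cost + 1))

/-- The state of the transition to the next stage after the first `i` edges, where `B` is the set of
the vertices that the search has reached. -/
structure AdvanceState (N : Net (Fin n) (Fin m)) (nx : HalfEdge m → Option (HalfEdge m))
    (fs : Fin n → Option (HalfEdge m)) (t : Fin n) (B : Finset (Fin n)) (α β : ℕ → ℕ) (i : ℕ)
    (h : View) : Prop extends Stores N nx fs t h where
  counter : h.var .counter = i
  cursor : h.var .cursor = 2 * i + 1
  unmarked : ∀ x : HalfEdge m,
    h.var .stamp - h.arr .mark (h.arr .first (N.site x)) ≠ 0 ↔ N.site x ∉ B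
  inSource : ∀ v : Fin n, h.arr .inSource v ≠ 0 ↔
    α v ≠ 0 ∨ ∃ x : HalfEdge m, (x.1 : ℕ) < i ∧ N.site x = v ∧ v ∉ B
  supply : ∀ v ∈ B, h.arr .supply v =
    β v + if v = t then 0 else
      (Finset.univ.filter fun e : Fin m => (e : ℕ) < i ∧ N.tail e ∉ B ∧ N.head e = v).card

theorem advanceStep_wp {B : Finset (Fin n)} {i : ℕ} {h : View}
    (hA : AdvanceState N nx fs t B α β i h) (hi : i < m) :
    advanceStep.wp I (fun h' => AdvanceState N nx fs t B α β (i + 1) h' ∧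
      h'.arr .residual = h.arr .residual ∧ h'.arr .mark = h.arr .mark ∧
      h'.var .stamp = h.var .stamp ∧ h'.var .stages = h.var .stages) h := by
  set e : Fin m := ⟨i, hi⟩ with he
  have h₁ : h.arr .site (2 * i + 1) = N.tail e := hA.site (e, false)
  have h₂ : h.arr .site (2 * i + 1 + 1) = N.head e := hA.site (e, true)
  have h₃ := hA.unmarked (e, false)
  have h₄ := hA.unmarked (e, true)
  rw [Net.site_false] at h₃
  rw [Net.site_true] at h₄
  -- The effect of one more edge on the two tables.
  have hex : ∀ v, (∃ x : HalfEdge m, (x.1 : ℕ) < i + 1 ∧ N.site x = v ∧ v ∉ B) ↔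
      (∃ x : HalfEdge m, (x.1 : ℕ) < i ∧ N.site x = v ∧ v ∉ B) ∨
        (v = N.head e ∧ v ∉ B) ∨ (v = N.tail e ∧ v ∉ B) := by
    intro v
    constructor
    · rintro ⟨⟨e', b⟩, hlt, hx, hv⟩
      rcases Nat.lt_succ_iff_lt_or_eq.1 hlt with hlt | heq
      · exact .inl ⟨_, hlt, hx, hv⟩
      · obtain rfl : e' = e := Fin.ext heq
        cases b
        · exact .inr (.inr ⟨hx.symm, hv⟩)
        · exact .inr (.inl ⟨hx.symm, hv⟩)
    · rintro (⟨x, hlt, hx⟩ | ⟨rfl, hv⟩ | ⟨rfl, hv⟩)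
      · exact ⟨x, by omega, hx⟩
      · exact ⟨(e, true), by simp [he], rfl, hv⟩
      · exact ⟨(e, false), by simp [he], rfl, hv⟩
  have hcard : ∀ v, (Finset.univ.filter fun e : Fin m =>
        (e : ℕ) < i + 1 ∧ N.tail e ∉ B ∧ N.head e = v).card =
      (Finset.univ.filter fun e : Fin m => (e : ℕ) < i ∧ N.tail e ∉ B ∧ N.head e = v).card +
        if N.tail e ∉ B ∧ N.head e = v then 1 else 0 := by
    intro v
    have : ∀ e' : Fin m, ((e' : ℕ) < i + 1 ∧ N.tail e' ∉ B ∧ N.head e' = v) ↔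
        ((e' : ℕ) < i ∧ N.tail e' ∉ B ∧ N.head e' = v) ∨
          (e' = e ∧ N.tail e ∉ B ∧ N.head e = v) := by
      intro e'
      rw [Nat.lt_succ_iff_lt_or_eq]
      constructor
      · rintro ⟨hlt | heq, h⟩
        · exact .inl ⟨hlt, h⟩
        · obtain rfl : e' = e := Fin.ext heq
          exact .inr ⟨rfl, h⟩
      · rintro (⟨hlt, h⟩ | ⟨rfl, h⟩)
        · exact ⟨.inl hlt, h⟩
        · exact ⟨.inr rfl, h⟩
    simp only [this, Finset.filter_or]
    rw [Finset.card_union_of_disjoint]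
    · congr 1
      split_ifs with h
      · simp [h, Finset.filter_eq']
      · simp [h]
    · rw [Finset.disjoint_left]
      intro e' h₁ h₂
      simp only [Finset.mem_filter, Finset.mem_univ, true_and] at h₁ h₂
      rw [h₂.1] at h₁
      simp [he] at h₁
  have hupd : ∀ (a : ℕ → ℕ) (u v : Fin n) (x : ℕ), Function.update a (u : ℕ) x (v : ℕ) =
      if v = u then x else a v := by
    intro a u v x
    simp [Function.update_apply, Fin.ext_iff]
  simp only [advanceStep, fetch, scanNext, Code.wp, Term.Safe, Term.eval, true_and, and_true,
    Term.unmarked, Term.distinct_safe, View.setVar_var_self, View.setVar_arr, View.setArr_var,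
    reduceCtorEq, not_false_eq_true, View.setVar_var_of_ne, View.setArr_arr_of_ne, ne_eq,
    hA.counter, hA.cursor, h₁, h₂]
  have key : ∀ h' : View, Stores N nx fs t h' → h'.var .counter = i + 1 →
      h'.var .cursor = 2 * i + 1 + 2 → h'.arr .first = h.arr .first → h'.arr .mark = h.arr .mark →
      h'.var .stamp = h.var .stamp →
      (∀ v : Fin n, h'.arr .inSource v ≠ 0 ↔
        h.arr .inSource v ≠ 0 ∨ (v = N.head e ∧ v ∉ B) ∨ (v = N.tail e ∧ v ∉ B)) →
      (∀ v ∈ B, h'.arr .supply v =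
        h.arr .supply v + if v = t then 0 else if N.tail e ∉ B ∧ N.head e = v then 1 else 0) →
      AdvanceState N nx fs t B α β (i + 1) h' := by
    intro h' k₁ k₂ k₃ k₄ k₅ k₆ k₇ k₈
    refine ⟨k₁, k₂, by rw [k₃]; ring, fun x => ?_, fun v => ?_, fun v hv => ?_⟩
    · rw [k₄, k₅, k₆]
      exact hA.unmarked x
    · rw [k₇, hA.inSource, hex, or_assoc]
    · rw [k₈ v hv, hA.supply v hv, hcard]
      split_ifs <;> omega
  have h₃' := not_iff_not.1 h₃
  have h₄' := not_iff_not.1 h₄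
  have hdist : ∀ h' : View, h'.var .head = N.head e → h'.var .target = h.var .target →
      ((Term.distinct .head .target).eval I h' = 0 ↔ N.head e = t) := by
    intro h' k₁ k₂
    rw [← not_iff_not, ← ne_eq, Term.distinct_eval, k₁, k₂, hA.target, ne_eq, Fin.ext_iff]
  rw [hdist _ (by simp) (by simp)]
  simp only [h₃', h₄']
  refine ⟨fun hb => ⟨fun ha => ⟨fun h => absurd trivial h, fun _ => ?_⟩, fun ha => ?_⟩,
    fun hb => ⟨fun ha => ⟨fun hd => ?_, fun hd => ?_⟩, fun ha => ?_⟩⟩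
  all_goals
    refine key _ (hA.toStores.congr (by simp) (by simp) (by simp)) (by simp) (by simp) (by simp)
      (by simp) (by simp) (fun v => ?_) (fun v hv => ?_)
  all_goals
    simp only [View.setVar_arr, View.setArr_arr_self, ne_eq, reduceCtorEq, not_false_eq_true,
      View.setArr_arr_of_ne, hupd]
    grind

theorem scanMore_eval {h : View} {i : ℕ} (hm : h.var .edgeCount = m)
    (hi : h.var .counter = i) : scanMore.eval I h = m - i := by
  simp [scanMore, Term.eval, hm, hi]

theorem scanMore_safe {h : View} : scanMore.Safe I h := by
  simp [scanMore, Term.Safe]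

theorem advance_triple {B : Finset (Fin n)} {h : View} (hF : Stores N nx fs t h)
    (hB : ∀ x : HalfEdge m,
      h.var .stamp - h.arr .mark (h.arr .first (N.site x)) ≠ 0 ↔ N.site x ∉ B) :
    Triple I h advance (advanceCost m) fun h' =>
      AdvanceState N nx fs t B (h.arr .inSource) (h.arr .supply) m h' ∧
      h'.arr .residual = h.arr .residual ∧ h'.arr .mark = h.arr .mark ∧
      h'.var .stamp = h.var .stamp ∧ h'.var .stages = h.var .stages - 1 := by
  refine (Code.triple (Q := fun h' =>
      AdvanceState N nx fs t B (h.arr .inSource) (h.arr .supply) 0 h' ∧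
      h'.arr .residual = h.arr .residual ∧ h'.arr .mark = h.arr .mark ∧
      h'.var .stamp = h.var .stamp ∧ h'.var .stages = h.var .stages - 1) _ ?_).seq
    fun h₁ hh₁ => ?_
  · simp only [scanInit, Code.wp, Term.Safe, Term.eval, true_and, and_true]
    refine ⟨⟨hF.congr (by simp) (by simp) (by simp), by simp, by simp, by simpa using hB, by simp,
      by simp⟩, by simp, by simp, by simp, by simp⟩
  · refine Triple.loop (J := fun b h' => ∃ i,
      AdvanceState N nx fs t B (h.arr .inSource) (h.arr .supply) i h' ∧
      h'.arr .residual = h.arr .residual ∧ h'.arr .mark = h.arr .mark ∧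
      h'.var .stamp = h.var .stamp ∧ h'.var .stages = h.var .stages - 1 ∧ b + i = m)
      (fun _ _ _ => scanMore_safe) ?_ ?_ m h₁ ?_
    · rintro b h' ⟨i, hA, k₁, k₂, k₃, k₄, hb⟩ hne
      rw [scanMore_eval hA.edgeCount hA.counter] at hne
      refine (Code.triple _ (advanceStep_wp hA (by omega))).weaken le_rfl ?_
      rintro h'' ⟨hA', l₁, l₂, l₃, l₄⟩
      exact ⟨b - 1, by omega, i + 1, hA', l₁.trans k₁, l₂.trans k₂, l₃.trans k₃, l₄.trans k₄,
        by omega⟩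
    · rintro b h' ⟨i, hA, k₁, k₂, k₃, k₄, hb⟩ h0
      rw [scanMore_eval hA.edgeCount hA.counter] at h0
      obtain rfl : i = m := by omega
      exact ⟨hA, k₁, k₂, k₃, k₄⟩
    · obtain ⟨hA, k₁, k₂, k₃, k₄⟩ := hh₁
      exact ⟨0, hA, k₁, k₂, k₃, k₄, rfl⟩

end Rounds

section Stages

open HalfEdge

/-! ### The stages -/

/-- One round: a search, followed by an augmentation or by the transition to the next stage. -/
def round : Prog :=
  .seq search (.branch (Term.var .found).compile augment advance)

/-- A bound for the number of steps of a round. -/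
def roundCost (m : ℕ) : ℕ :=
  searchCost m + ((Term.var .found).compile.cost + 1 + (augmentCost m + advanceCost m))

variable {n m : ℕ} {N : Net (Fin n) (Fin m)} {nx : HalfEdge m → Option (HalfEdge m)}
  {fs : Fin n → Option (HalfEdge m)} {s t : Fin n} {ρ α β : ℕ → ℕ} {J st : ℕ}
  {q : List (HalfEdge m)} {I : List ℕ} {S : Finset (Fin n)} {c r : Fin n → ℕ} {g : Fin m → ℤ}

/-- All half-edges at a vertex that a completed search has reached are in the queue. -/
theorem SearchState.mem_of_seen {h : View} (hI : IsIncidence N Set.univ nx fs)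
    (hS : SearchState N nx fs t ρ α β st q q.length q.length h) {x : HalfEdge m}
    (hx : Seen fs q (N.site x)) : x ∈ q := by
  obtain ⟨y, hy, hyq⟩ := hx
  refine hI.cover {x | x ∈ q} (fun x hx z hz => ?_) x (Set.mem_univ _) y hy hyq
  obtain ⟨k, hk, rfl⟩ := List.getElem_of_mem hx
  exact hS.next_closed k hk hk z hz

theorem SearchState.residualClosed {h : View} (hI : IsIncidence N Set.univ nx fs)
    (hS : SearchState N nx fs t ρ α β st q q.length q.length h) (hρ : IsResidual ρ g)
    {B : Finset (Fin n)} (hB : ∀ v, v ∈ B ↔ Seen fs q v) : N.ResidualClosed g B := by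
  have key : ∀ x : HalfEdge m, N.site x ∈ B → ρ x.code ≠ 0 → N.site x.opp ∈ B := by
    intro x hx hne
    have hxq := hS.mem_of_seen hI ((hB _).1 hx)
    obtain ⟨k, hk, rfl⟩ := List.getElem_of_mem hxq
    obtain ⟨y, hy⟩ := hI.fs_isSome q[k].opp (Set.mem_univ _)
    exact (hB _).2 ⟨y, hy, hS.arc_closed k hk hk hne y hy⟩
  constructor
  · intro e he hg
    exact key (e, true) he (by have := (hρ e).2; omega)
  · intro e he hg
    exact key (e, false) he (by have := (hρ e).1; omega)

theorem SearchTree.subset_of_residualClosed {via : ℕ → ℕ} (hI : IsIncidence N Set.univ nx fs)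
    (hT : SearchTree N fs t ρ via q) (hρ : IsResidual ρ g) {Y : Finset (Fin n)} (hY : t ∈ Y)
    (hc : N.ResidualClosed g Y) (h01 : ∀ e, g e = 0 ∨ g e = 1) {v : Fin n} (hv : Seen fs q v) :
    v ∈ Y := by
  obtain ⟨y, hy, hyq⟩ := hv
  rw [← hI.fs_site v y hy]
  refine hT.minimal Y hY (fun x hx hne => ?_) y hyq
  obtain ⟨e, b⟩ := x
  have := hρ e
  have h01 := h01 e
  cases b
  · exact hc.2 e hx (by omega)
  · exact hc.1 e hx (by omega)

/-- The state between two rounds, after `i` completed stages and with `j` stages to come. -/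
structure MainState (N : Net (Fin n) (Fin m)) (nx : HalfEdge m → Option (HalfEdge m))
    (fs : Fin n → Option (HalfEdge m)) (s t : Fin n) (f i j : ℕ) (S : Finset (Fin n))
    (c : Fin n → ℕ) (g : Fin m → ℤ) (h : View) : Prop extends Stores N nx fs t h where
  stage : N.Stage s t f i S c
  flow : N.IsFlowAt t S c (fun v => h.arr .supply v) g t
  residual : IsResidual (h.arr .residual) g
  stages : h.var .stages = j
  inSource : ∀ x : HalfEdge m, h.arr .inSource (N.site x) ≠ 0 ↔ N.site x ∈ S
  mark_le : ∀ x : HalfEdge m, h.arr .mark x.code ≤ h.var .stamp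

/-- The outcome of all the stages: a maximum flow of the last stage. -/
def Finished (N : Net (Fin n) (Fin m)) (s t : Fin n) (f k : ℕ) (g : Fin m → ℤ) : Prop :=
  ∃ S c r A, N.Stage s t f k S c ∧ N.IsFlowAt t S c r g t ∧ N.IsFarthestMinCut t S c A ∧
    (N.cut Finset.univ c A : ℤ) = N.inflow g t

/-- A round either increases the value of the flow, or completes a stage. -/
theorem round_triple {G : Digraph (Fin n)} {f i j : ℕ} {h : View}
    (hI : IsIncidence N Set.univ nx fs) (ht : ∃ y, fs t = some y) (hst : s ≠ t)
    (hN : N.Represents Finset.univ G) (hf : IsMaxFlowValue G s t f)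
    (hM : MainState N nx fs s t f i (j + 1) S c g h) :
    Triple I h round (roundCost m) fun h' =>
      (∃ g', MainState N nx fs s t f i (j + 1) S c g' h' ∧ N.inflow g' t = N.inflow g t + 1) ∨
      (Finished N s t f i g ∧
        ∃ S' c', MainState N nx fs s t f (i + 1) j S' c' g h') := by
  have hF : Frame N nx fs t (h.arr .residual) (h.arr .inSource) (h.arr .supply) (j + 1) h :=
    ⟨hM.toStores, rfl, rfl, rfl, hM.stages⟩
  refine (search_triple hI ht hF hM.mark_le).seq fun h₁ hh₁ => ?_
  obtain ⟨hF₁, q, hS₁⟩ := hh₁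
  have hflow₁ : N.IsFlowAt t S c (fun v => h₁.arr .supply v) g t := hF₁.supply ▸ hM.flow
  have hres₁ : IsResidual (h₁.arr .residual) g := hF₁.residual ▸ hM.residual
  have hmark₁ : ∀ x : HalfEdge m, h₁.arr .mark x.code ≤ h₁.var .stamp :=
    fun x => hS₁.stamp ▸ hS₁.mark_le x
  refine Triple.branch (by simp [Term.Safe]) (fun hne => ?_) (fun h0 => ?_)
  · obtain ⟨u, hu, hut, hseen, hsrc⟩ := hS₁.found hne
    have hsrc' : u ∈ S ∨ h₁.arr .supply u ≠ 0 := by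
      obtain ⟨y, hy, -⟩ := hseen
      have := hM.inSource y
      rw [hI.fs_site u y hy] at this
      rw [← this, hF₁.supply]
      omega
    have htree := hS₁.tree
    rw [← hF₁.residual] at htree
    refine (augment_triple hF₁.toStores htree hu hut hseen hflow₁ hres₁ hsrc').weaken
      (by omega) ?_
    rintro h₂ ⟨k₁, k₂, k₃, k₄, k₅, g', k₆, k₇, k₈⟩
    refine .inl ⟨g', ⟨k₁, hM.stage, k₆, k₇, by rw [k₄, hF₁.stages], ?_, ?_⟩, k₈⟩
    · rw [k₅, hF₁.inSource]
      exact hM.inSource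
    · rw [k₂, k₃]
      exact hmark₁
  · classical
    set B : Finset (Fin n) := {v | Seen fs q v} with hBdef
    have hB : ∀ v, v ∈ B ↔ Seen fs q v := by simp [hBdef]
    have htB : t ∈ B := (hB t).2 hS₁.tree.root
    have hnot : ∀ u ∈ B, u ≠ t → h.arr .inSource u + h.arr .supply u = 0 :=
      fun u hu hut => hS₁.not_found h0 u hut ((hB u).1 hu)
    have hdisj : Disjoint B S := by
      rw [Finset.disjoint_left]
      intro u hu huS
      have hut : u ≠ t := fun h => hM.stage.target_notMem hst (h ▸ huS)
      obtain ⟨y, hy, -⟩ := (hB u).1 hu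
      have h₁ := hM.inSource y
      rw [hI.fs_site u y hy] at h₁
      have h₂ := hnot u hu hut
      have h₃ := h₁.2 huS
      omega
    have hcut := hM.flow.isFarthestMinCut hM.stage.supply_target htB
      (hS₁.residualClosed hI hM.residual hB)
      (fun Y hY hc v hv => hS₁.tree.subset_of_residualClosed hI hM.residual hY hc
        hM.flow.zero_or_one ((hB v).1 hv)) hdisj (fun v hv => by
        by_cases hvt : v = t
        · rw [hvt]; exact hM.flow.rest_target
        · have := hnot v hv hvt
          omega)
    have hle := hN.inflow_le hst hf hM.stage hM.flow
    have hstage := hM.stage.succ hcut.1 (by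
      have := hcut.2.trans_le hle
      exact_mod_cast this)
    refine (advance_triple (B := B) hF₁.toStores fun x => ?_).weaken (by omega) ?_
    · obtain ⟨y, hy⟩ := hI.fs_isSome x (Set.mem_univ _)
      have : h₁.arr .first (N.site x) = y.code := by rw [hF₁.first, hy]; rfl
      rw [this, hS₁.stamp, hS₁.unmarked_iff, hB, not_iff_not]
      refine ⟨fun h => ⟨y, hy, h⟩, ?_⟩
      rintro ⟨z, hz, hzq⟩
      rw [hy, Option.some.injEq] at hz
      exact hz ▸ hzq
    · rintro h₂ ⟨hA, k₁, k₂, k₃, k₄⟩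
      refine .inr ⟨⟨S, c, _, Bᶜ, hM.stage, hM.flow, hcut.1, hcut.2⟩, Bᶜ, _,
        ⟨hA.toStores, hstage, ?_, by rw [k₁]; exact hres₁, by rw [k₄, hF₁.stages]; rfl, fun x => ?_,
          by rw [k₂, k₃]; exact hmark₁⟩⟩
      · refine hflow₁.enlarge hcut.1.subset (fun v hv hvt => ?_) ?_
        · rw [hA.supply v (by simpa using hv)]
          simp [Net.bump]
        · rw [hA.supply t htB]
          simpa using hflow₁.rest_target
      · rw [hA.inSource, hF₁.inSource, hM.inSource, Finset.mem_compl]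
        constructor
        · rintro (h | ⟨-, -, -, h⟩)
          · exact fun hB => Finset.disjoint_left.1 hdisj hB h
          · exact h
        · exact fun h => .inr ⟨x, x.1.2, rfl, h⟩

/-- All the rounds. -/
def rounds : Prog := .loop (Term.var .stages).compile round

/-- A bound for the number of steps of `b` rounds. -/
def roundsCost (m b : ℕ) : ℕ :=
  b * ((Term.var .stages).compile.cost + 1 + roundCost m) + ((Term.var .stages).compile.cost + 1)

theorem rounds_triple {G : Digraph (Fin n)} {f k : ℕ} {h : View}
    (hI : IsIncidence N Set.univ nx fs) (ht : ∃ y, fs t = some y) (hst : s ≠ t)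
    (hN : N.Represents Finset.univ G) (hf : IsMaxFlowValue G s t f)
    (hM : MainState N nx fs s t f 0 (k + 1) {s} 0 0 h) :
    Triple I h rounds (roundsCost m (2 ^ k * f + k + 1)) fun h' => Stores N nx fs t h' ∧
      ∃ g, IsResidual (h'.arr .residual) g ∧ Finished N s t f k g := by
  refine Triple.loop (J := fun b h' =>
    (∃ i j S c g, MainState N nx fs s t f i (j + 1) S c g h' ∧ i + j = k ∧
      (b : ℤ) = 2 ^ k * f - N.inflow g t + (j + 1)) ∨
    (h'.var .stages = 0 ∧ Stores N nx fs t h' ∧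
      ∃ g, IsResidual (h'.arr .residual) g ∧ Finished N s t f k g))
    (fun _ _ _ => by simp [Term.Safe]) ?_ ?_ _ h ?_
  · rintro b h' (⟨i, j, S, c, g, hM, hij, hb⟩ | ⟨h0, -⟩) hne
    · have hle : ∀ {i S c g}, i ≤ k → N.Stage s t f i S c →
          ∀ {h : View}, N.IsFlowAt t S c (fun v => h.arr .supply v) g t →
          N.inflow g t ≤ 2 ^ k * f := by
        intro i S c g hik hs h hg
        have h₁ := hN.inflow_le hst hf hs hg
        have h₂ : 2 ^ i * f ≤ 2 ^ k * f :=
          Nat.mul_le_mul_right _ (Nat.pow_le_pow_right (by norm_num) hik)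
        exact h₁.trans (by exact_mod_cast h₂)
      refine (round_triple hI ht hst hN hf hM).weaken le_rfl ?_
      have hlt := hle (by omega) hM.stage hM.flow
      rintro h'' (⟨g', hM', hv⟩ | ⟨hfin, S', c', hM'⟩)
      · have := hle (by omega) hM'.stage hM'.flow
        exact ⟨b - 1, by omega, .inl ⟨i, j, S, c, g', hM', hij, by rw [hv]; omega⟩⟩
      · rcases j with _ | j
        · obtain rfl : i = k := by omega
          exact ⟨0, by omega, .inr ⟨hM'.stages, hM'.toStores, g, hM'.residual, hfin⟩⟩
        · refine ⟨b - 1, by omega, .inl ⟨i + 1, j, S', c', g, hM', by omega, ?_⟩⟩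
          push_cast at hb
          omega
    · exact absurd h0 hne
  · rintro b h' (⟨i, j, S, c, g, hM, -⟩ | ⟨-, h⟩) h0
    · exact absurd (hM.stages.symm.trans h0) (Nat.succ_ne_zero j)
    · exact h
  · refine .inl ⟨0, k, _, _, _, hM, by omega, ?_⟩
    simp [Net.inflow]
    ring

end Stages

section Algorithm

open HalfEdge

/-! ### Input and output -/

/-- Read the parameters of the instance. The flag makes `source` the only source. -/
def loadInit : Code :=
  .assign .edgeCount (.input (.lit 1)) ;;
  .assign .source (.input (.lit 2)) ;;
  .assign .target (.input (.lit 3)) ;;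
  .assign .stages ((Term.input (.lit 4)).add (.lit 1)) ;;
  .store .inSource (.var .source) (.lit 1) ;;
  scanInit

/-- Read an edge, and put its two ends at the front of the incidence lists. -/
def loadStep : Code :=
  .assign .tail (.input ((Term.var .cursor).add (.lit 4))) ;;
  .assign .head (.input ((Term.var .cursor).add (.lit 5))) ;;
  .assign .succ ((Term.var .cursor).add (.lit 1)) ;;
  .store .site (.var .cursor) (.var .tail) ;;
  .store .site (.var .succ) (.var .head) ;;
  .store .partner (.var .cursor) (.var .succ) ;;
  .store .partner (.var .succ) (.var .cursor) ;;
  .store .next (.var .cursor) (.get .first (.var .tail)) ;;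
  .store .first (.var .tail) (.var .cursor) ;;
  .store .next (.var .succ) (.get .first (.var .head)) ;;
  .store .first (.var .head) (.var .succ) ;;
  .store .residual (.var .succ) (.lit 1) ;;
  scanNext

/-- Read the input. -/
def load : Prog := .seq loadInit.compile (.loop scanMore.compile loadStep.compile)

/-- Print an edge if it does not enter the target, or carries flow. -/
def emitStep : Code :=
  fetch ;;
  .cond ((Term.distinct .head .target).add (.get .residual (.var .cursor)))
    (.emit (.var .tail) ;; .emit (.var .head)) .skip ;;
  scanNext

/-- Print the subgraph. -/
def emitAll : Prog := .seq scanInit.compile (.loop scanMore.compile emitStep.compile)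

/-- A bound for the number of steps that the input takes. -/
def loadCost (m : ℕ) : ℕ :=
  loadInit.cost + (m * (scanMore.compile.cost + 1 + loadStep.cost) + (scanMore.compile.cost + 1))

/-- A bound for the number of steps that the output takes. -/
def emitCost (m : ℕ) : ℕ :=
  scanInit.cost + (m * (scanMore.compile.cost + 1 + emitStep.cost) + (scanMore.compile.cost + 1))

section Input

variable {n : ℕ} (L : List (Fin n × Fin n)) (s t : Fin n) (k : ℕ)

/-- The network of a list of edges. -/
def netOfList : Net (Fin n) (Fin L.length) := ⟨fun e => (L.get e).1, fun e => (L.get e).2⟩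

theorem encodeEdges_length : (encodeEdges L).length = 2 * L.length := by
  induction L with
  | nil => rfl
  | cons a L ih => simp [encodeEdges] at ih ⊢; omega

theorem encodeEdges_getD (i : ℕ) (hi : i < L.length) :
    (encodeEdges L).getD (2 * i) 0 = L[i].1 ∧ (encodeEdges L).getD (2 * i + 1) 0 = L[i].2 := by
  induction L generalizing i with
  | nil => simp at hi
  | cons a L ih =>
    cases i with
    | zero => simp [encodeEdges]
    | succ i => exact ih i (by simpa using hi)

theorem encodeInput_length : (encodeInput L s t k).length = 2 * L.length + 5 := by
  simp [encodeInput, encodeEdges_length]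

theorem encodeInput_getD (e : Fin L.length) :
    (encodeInput L s t k).getD (2 * e + 1 + 4) 0 = (netOfList L).tail e ∧
      (encodeInput L s t k).getD (2 * e + 1 + 5) 0 = (netOfList L).head e :=
  encodeEdges_getD L e e.2

/-- The state of the input after `i` edges have been read. -/
structure LoadState (nx : HalfEdge L.length → Option (HalfEdge L.length))
    (fs : Fin n → Option (HalfEdge L.length)) (i : ℕ) (h : View) : Prop where
  incidence : IsIncidence (netOfList L) {x | (x.1 : ℕ) < i} nx fs
  site : ∀ x : HalfEdge L.length, (x.1 : ℕ) < i → h.arr .site x.code = (netOfList L).site x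
  partner : ∀ x : HalfEdge L.length, (x.1 : ℕ) < i → h.arr .partner x.code = x.opp.code
  next : ∀ x : HalfEdge L.length, (x.1 : ℕ) < i → h.arr .next x.code = optCode (nx x)
  first : ∀ v : Fin n, h.arr .first v = optCode (fs v)
  residual : ∀ x : HalfEdge L.length,
    h.arr .residual x.code = if (x.1 : ℕ) < i ∧ x.2 then 1 else 0
  inSource : h.arr .inSource = Function.update (fun _ => 0) (s : ℕ) 1
  supply : h.arr .supply = fun _ => 0
  mark : h.arr .mark = fun _ => 0
  edgeCount : h.var .edgeCount = L.length
  target : h.var .target = t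
  stages : h.var .stages = k + 1
  counter : h.var .counter = i
  cursor : h.var .cursor = 2 * i + 1
  out : h.out = []

variable {L s t k} {nx : HalfEdge L.length → Option (HalfEdge L.length)}
  {fs : Fin n → Option (HalfEdge L.length)}

theorem loadInit_wp : loadInit.wp (encodeInput L s t k)
    (LoadState L s t k (fun _ => none) (fun _ => none) 0) View.zero := by
  have h₁ : ∀ i < 5, i < (encodeInput L s t k).length := by
    intro i hi
    rw [encodeInput_length]
    omega
  have h₂ : (encodeInput L s t k).getD 1 0 = L.length := rfl
  have h₃ : (encodeInput L s t k).getD 2 0 = s := rfl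
  have h₄ : (encodeInput L s t k).getD 3 0 = t := rfl
  have h₅ : (encodeInput L s t k).getD 4 0 = k := rfl
  simp only [loadInit, scanInit, Code.wp, Term.Safe, Term.eval, true_and, and_true, h₂, h₃, h₄, h₅]
  refine ⟨h₁ 1 (by norm_num), h₁ 2 (by norm_num), h₁ 3 (by norm_num), h₁ 4 (by norm_num), ?_⟩
  constructor
  · simpa using isIncidence_empty (netOfList L)
  all_goals simp [View.zero, optCode]

theorem loadStep_wp {i : ℕ} {h : View} (hS : LoadState L s t k nx fs i h) (hi : i < L.length) :
    loadStep.wp (encodeInput L s t k) (fun h' => ∃ nx' fs', LoadState L s t k nx' fs' (i + 1) h')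
      h := by
  set e : Fin L.length := ⟨i, hi⟩ with he
  have hin := encodeInput_getD L s t k e
  have hlen := encodeInput_length L s t k
  have hupd : ∀ (a : ℕ → ℕ) (u v : Fin n) (x : ℕ), Function.update a (u : ℕ) x (v : ℕ) =
      if v = u then x else a v := by
    intro a u v x
    simp [Function.update_apply, Fin.ext_iff]
  have hcod : ∀ (a : ℕ → ℕ) (x y : HalfEdge L.length) (b : ℕ),
      Function.update a y.code b x.code = if x = y then b else a x.code := by
    intro a x y b
    simp only [Function.update_apply, code_inj]
  have hD : {x : HalfEdge L.length | (x.1 : ℕ) < i + 1} =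
      insert (e, true) (insert (e, false) {x | (x.1 : ℕ) < i}) := by
    ext ⟨e', b⟩
    simp only [Set.mem_ofPred_eq, Set.mem_insert_iff, Prod.mk.injEq, Nat.lt_succ_iff_lt_or_eq]
    have : (e' : ℕ) = i ↔ e' = e := by simp [he, Fin.ext_iff]
    rw [this]
    cases b <;> simp <;> tauto
  have hI := (hS.incidence.insert (y := (e, false)) (by simp [he])).insert (y := (e, true))
    (by simp [he])
  rw [← hD] at hI
  have hmem : ∀ x : HalfEdge L.length, (x.1 : ℕ) < i + 1 →
      x = (e, true) ∨ x = (e, false) ∨ (x.1 : ℕ) < i ∧ x ≠ (e, true) ∧ x ≠ (e, false) := by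
    intro x hx
    have : x ∈ insert (e, true) (insert (e, false) {x : HalfEdge L.length | (x.1 : ℕ) < i}) :=
      hD ▸ hx
    have h₁ : (x.1 : ℕ) < i → x ≠ (e, true) ∧ x ≠ (e, false) := by
      intro h
      constructor <;> rintro rfl <;> simp [he] at h
    simp only [Set.mem_insert_iff, Set.mem_ofPred_eq] at this
    tauto
  have hc₁ : 2 * i + 1 = code (e, false) := rfl
  have hc₂ : code (e, false) + 1 = code (e, true) := rfl
  simp only [loadStep, scanNext, Code.wp, Term.Safe, Term.eval, true_and, View.setVar_var_self,
    View.setVar_arr, View.setArr_var, ne_eq, reduceCtorEq, not_false_eq_true,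
    View.setVar_var_of_ne, View.setArr_arr_of_ne, View.setArr_arr_self, hS.counter, hS.cursor]
  rw [show 2 * i + 1 + 4 = 2 * (e : ℕ) + 1 + 4 from rfl,
    show 2 * i + 1 + 5 = 2 * (e : ℕ) + 1 + 5 from rfl, hin.1, hin.2, hlen]
  refine ⟨by omega, by omega, _, _, hI, fun x hx => ?_, fun x hx => ?_, fun x hx => ?_, fun v => ?_,
    fun x => ?_, ?_, ?_, ?_, ?_, ?_, ?_, ?_, ?_, ?_⟩
  · simp only [View.setVar_arr, ne_eq, reduceCtorEq, not_false_eq_true, View.setArr_arr_of_ne,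
      View.setArr_arr_self, hc₁, hc₂, hcod]
    rcases hmem x hx with rfl | rfl | ⟨h₁, h₂, h₃⟩
    · simp
    · simp
    · simp [h₂, h₃, hS.site x h₁]
  · simp only [View.setVar_arr, ne_eq, reduceCtorEq, not_false_eq_true, View.setArr_arr_of_ne,
      View.setArr_arr_self, hc₁, hc₂, hcod]
    rcases hmem x hx with rfl | rfl | ⟨h₁, h₂, h₃⟩
    · simp
    · simp
    · simp [h₂, h₃, hS.partner x h₁]
  · simp only [View.setVar_arr, ne_eq, reduceCtorEq, not_false_eq_true, View.setArr_arr_of_ne,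
      View.setArr_arr_self, hc₁, hc₂, hcod]
    rcases hmem x hx with rfl | rfl | ⟨h₁, h₂, h₃⟩
    · simp [hupd, hS.first, Function.update_apply, apply_ite optCode]
    · simp [hS.first]
    · simp [h₂, h₃, hS.next x h₁]
  · simp only [View.setVar_arr, ne_eq, reduceCtorEq, not_false_eq_true, View.setArr_arr_of_ne,
      View.setArr_arr_self, hc₁, hc₂, hupd, hS.first, Function.update_apply, apply_ite optCode,
      optCode_some]
    rfl
  · simp only [View.setVar_arr, ne_eq, reduceCtorEq, not_false_eq_true, View.setArr_arr_of_ne,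
      View.setArr_arr_self, hc₁, hc₂, hcod, hS.residual]
    by_cases hx : x = (e, true)
    · simp [hx, he]
    · rw [if_neg hx]
      refine if_congr (and_congr_left fun hx₂ => ?_) rfl rfl
      have : (x.1 : ℕ) ≠ i := fun h => hx (Prod.ext (Fin.ext h) hx₂)
      omega
  · simpa using hS.inSource
  · simpa using hS.supply
  · simpa using hS.mark
  · simpa using hS.edgeCount
  · simpa using hS.target
  · simpa using hS.stages
  · simp
  · simp
    ring
  · simpa using hS.out

theorem load_triple : Triple (encodeInput L s t k) View.zero load (loadCost L.length)
    fun h => ∃ nx fs, LoadState L s t k nx fs L.length h := by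
  refine (Code.triple _ loadInit_wp).seq fun h₁ hh₁ => ?_
  refine Triple.loop (J := fun b h => ∃ i nx fs, LoadState L s t k nx fs i h ∧ b + i = L.length)
    (fun _ _ _ => scanMore_safe) ?_ ?_ L.length h₁ ⟨0, _, _, hh₁, rfl⟩
  · rintro b h ⟨i, nx, fs, hS, hb⟩ hne
    rw [scanMore_eval hS.edgeCount hS.counter] at hne
    refine (Code.triple _ (loadStep_wp hS (by omega))).weaken le_rfl ?_
    rintro h' ⟨nx', fs', hS'⟩
    exact ⟨b - 1, by omega, i + 1, nx', fs', hS', by omega⟩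
  · rintro b h ⟨i, nx, fs, hS, hb⟩ h0
    rw [scanMore_eval hS.edgeCount hS.counter] at h0
    obtain rfl : i = L.length := by omega
    exact ⟨nx, fs, hS⟩

theorem LoadState.isIncidence {h : View} (hS : LoadState L s t k nx fs L.length h) :
    IsIncidence (netOfList L) Set.univ nx fs := by
  have : {x : HalfEdge L.length | (x.1 : ℕ) < L.length} = Set.univ := by
    ext x
    simp
  exact this ▸ hS.incidence

theorem LoadState.mainState {f : ℕ} {h : View} (hS : LoadState L s t k nx fs L.length h) :
    MainState (netOfList L) nx fs s t f 0 (k + 1) {s} 0 0 h where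
  site x := hS.site x x.1.2
  partner x := hS.partner x x.1.2
  next x := hS.next x x.1.2
  first := hS.first
  edgeCount := hS.edgeCount
  target := hS.target
  out := hS.out
  stage := .zero
  flow := by
    have : (fun v : Fin n => h.arr .supply v) = 0 := by
      rw [hS.supply]
      rfl
    rw [this]
    exact Net.isFlowAt_zero s t
  residual e := by
    rw [hS.residual, hS.residual]
    simp
  stages := hS.stages
  inSource x := by
    rw [hS.inSource, Function.update_apply]
    simp [Fin.ext_iff]
  mark_le x := by simp [hS.mark]

end Input

section Output

variable {n m : ℕ} {N : Net (Fin n) (Fin m)} {nx : HalfEdge m → Option (HalfEdge m)}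
  {fs : Fin n → Option (HalfEdge m)} {t : Fin n} {I : List ℕ}

/-- The edges in `K` among the first `i` edges. -/
def keptEdges (N : Net (Fin n) (Fin m)) (K : Finset (Fin m)) (i : ℕ) : List (Fin n × Fin n) :=
  (((List.finRange m).take i).filter (· ∈ K)).map fun e => (N.tail e, N.head e)

theorem keptEdges_succ (N : Net (Fin n) (Fin m)) (K : Finset (Fin m)) (e : Fin m) :
    keptEdges N K (e + 1) =
      keptEdges N K e ++ if e ∈ K then [(N.tail e, N.head e)] else [] := by
  have : (List.finRange m).take (e + 1) = (List.finRange m).take e ++ [e] := by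
    rw [List.take_succ_eq_append_getElem (by simp)]
    simp
  unfold keptEdges
  rw [this, List.filter_append, List.map_append]
  congr 1
  by_cases h : e ∈ K <;> simp [h]

theorem emitAll_triple {h : View} {g : Fin m → ℤ} {K : Finset (Fin m)} (hF : Stores N nx fs t h)
    (hg : IsResidual (h.arr .residual) g) (hK : ∀ e, e ∈ K ↔ N.head e ≠ t ∨ g e ≠ 0) :
    Triple I h emitAll (emitCost m) fun h' => h'.out = encodeEdges (keptEdges N K m) := by
  refine (Code.triple (Q := fun h' => h'.arr = h.arr ∧ h'.var .edgeCount = m ∧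
    h'.var .target = t ∧ h'.var .counter = 0 ∧ h'.var .cursor = 1 ∧ h'.out = []) _ ?_).seq
      fun h₁ hh₁ => ?_
  · simp [scanInit, Code.wp, Term.Safe, Term.eval, hF.edgeCount, hF.target, hF.out]
  · refine Triple.loop (J := fun b h' => ∃ i, h'.arr = h.arr ∧ h'.var .edgeCount = m ∧
      h'.var .target = t ∧ h'.var .counter = i ∧ h'.var .cursor = 2 * i + 1 ∧
      h'.out = encodeEdges (keptEdges N K i) ∧ b + i = m)
      (fun _ _ _ => scanMore_safe) ?_ ?_ m h₁ ?_
    · rintro b h' ⟨i, k₁, k₂, k₃, k₄, k₅, k₆, hb⟩ hne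
      rw [scanMore_eval k₂ k₄] at hne
      have hi : i < m := by omega
      set e : Fin m := ⟨i, hi⟩ with he
      have h₁ : h.arr .site (2 * i + 1) = N.tail e := hF.site (e, false)
      have h₂ : h.arr .site (2 * i + 1 + 1) = N.head e := hF.site (e, true)
      have h₃ : (h.arr .residual (2 * i + 1) : ℤ) = g e := (hg e).1
      have hkept : keptEdges N K (i + 1) =
        keptEdges N K i ++ if e ∈ K then [(N.tail e, N.head e)] else [] := keptEdges_succ N K e
      have hdist : ∀ h' : View, h'.var .head = N.head e → h'.var .target = t →
          ((Term.distinct .head .target).eval I h' = 0 ↔ N.head e = t) := by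
        intro h' k₁ k₂
        rw [← not_iff_not, ← ne_eq, Term.distinct_eval, k₁, k₂, ne_eq, Fin.ext_iff]
      have htest : ∀ h' : View, h'.var .head = N.head e → h'.var .target = t →
          ((Term.distinct .head .target).eval I h' + h.arr .residual (2 * i + 1) = 0 ↔ e ∉ K) := by
        intro h' k₁ k₂
        rw [Nat.add_eq_zero_iff, hdist h' k₁ k₂, hK, not_or, not_not, not_not, ← h₃]
        simp
      refine Triple.weaken (U := emitStep.cost) (Code.triple (Q := fun h' => h'.arr = h.arr ∧
        h'.var .edgeCount = m ∧ h'.var .target = t ∧ h'.var .counter = i + 1 ∧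
        h'.var .cursor = 2 * i + 1 + 2 ∧ h'.out = encodeEdges (keptEdges N K (i + 1))) _ ?_)
        le_rfl ?_
      · simp only [emitStep, fetch, scanNext, Code.wp, Term.Safe, Term.eval, true_and, and_true,
          Term.distinct_safe, View.setVar_var_self, View.setVar_arr, ne_eq, reduceCtorEq,
          not_false_eq_true, View.setVar_var_of_ne, k₁, k₄, k₅, h₁, h₂]
        rw [htest _ (by simp) (by simp [k₃])]
        refine ⟨fun hin => ?_, fun hin => ?_⟩
        · rw [not_not] at hin
          rw [hkept, if_pos hin]
          simp [k₁, k₂, k₃, k₄, k₅, k₆, encodeEdges]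
        · rw [hkept, if_neg hin]
          simp [k₂, k₃, k₆]
      · rintro h'' ⟨l₁, l₂, l₃, l₄, l₅, l₆⟩
        exact ⟨b - 1, by omega, i + 1, l₁, l₂, l₃, l₄, by omega, l₆, by omega⟩
    · rintro b h' ⟨i, k₁, k₂, k₃, k₄, k₅, k₆, hb⟩ h0
      rw [scanMore_eval k₂ k₄] at h0
      obtain rfl : i = m := by omega
      exact k₆
    · obtain ⟨k₁, k₂, k₃, k₄, k₅, k₆⟩ := hh₁
      exact ⟨0, k₁, k₂, k₃, k₄, k₅, by simp [k₆, keptEdges, encodeEdges], rfl⟩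

end Output

/-! ### The whole algorithm and its running time -/

/-- The address of the first cell behind the input. -/
def inputEnd : Expr := (Expr.lit 5).add ((Expr.load (.lit 1)).add (.load (.lit 1)))

/-- The algorithm. -/
def algorithm : Prog := .seq (.assign 0 inputEnd) (.seq load (.seq rounds emitAll))

/-- The constant in the bound for the running time. -/
def algorithmConstant : ℕ :=
  inputEnd.cost + 1 + loadCost 1 + 4 * roundsCost 1 1 + emitCost 1

theorem roundCost_le {m : ℕ} (hm : 1 ≤ m) : roundCost m ≤ m * roundCost 1 := by
  have key : ∀ a, a ≤ m * a := fun a => Nat.le_mul_of_pos_left a hm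
  unfold roundCost searchCost augmentCost advanceCost
  generalize (searchNext ;; searchArc).cost = c₁
  generalize searchInit.cost = c₂
  generalize queueNonempty.compile.cost = c₃
  generalize (Term.var Var.found).compile.cost = c₄
  generalize draw.cost = c₅
  generalize (Term.distinct Var.walker Var.target).compile.cost = c₆
  generalize walkStep.cost = c₇
  generalize (scanInit ;; Code.assign Var.stages ((Term.var Var.stages).sub (Term.lit 1))).cost = c₈
  generalize scanMore.compile.cost = c₉
  generalize advanceStep.cost = c₁₀
  have := key (c₂ + (c₃ + 1) + (c₄ + 1) + c₅ + (c₆ + 1) + c₈ + (c₉ + 1))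
  nlinarith

theorem algorithm_cost_le {m f k : ℕ} (hm : 1 ≤ m) (hf : 1 ≤ f) :
    inputEnd.cost + 1 + (loadCost m + (roundsCost m (2 ^ k * f + k + 1) + emitCost m)) ≤
      algorithmConstant * (2 ^ k * f * m) := by
  have key : ∀ a, a ≤ m * a := fun a => Nat.le_mul_of_pos_left a hm
  have h₁ : loadCost m ≤ m * loadCost 1 := by
    unfold loadCost
    generalize loadInit.cost = c₁
    generalize scanMore.compile.cost = c₂
    generalize loadStep.cost = c₃
    have := key (c₁ + c₂ + 1)
    nlinarith
  have h₂ : emitCost m ≤ m * emitCost 1 := by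
    unfold emitCost
    generalize scanInit.cost = c₁
    generalize scanMore.compile.cost = c₂
    generalize emitStep.cost = c₃
    have := key (c₁ + c₂ + 1)
    nlinarith
  have hk : k + 1 ≤ 2 ^ k := Nat.lt_two_pow_self
  have hkf : 2 ^ k ≤ 2 ^ k * f := Nat.le_mul_of_pos_right _ hf
  have h₃ : roundsCost m (2 ^ k * f + k + 1) ≤ 4 * (2 ^ k * f) * (m * roundsCost 1 1) := by
    have hr := roundCost_le hm
    unfold roundsCost
    generalize (Term.var Var.stages).compile.cost = c at *
    have h₄ : c + 1 + roundCost m ≤ m * (c + 1 + roundCost 1) := by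
      have := key (c + 1)
      nlinarith
    calc (2 ^ k * f + k + 1) * (c + 1 + roundCost m) + (c + 1)
        ≤ (2 ^ k * f + k + 1) * (c + 1 + roundCost m) + (c + 1 + roundCost m) := by omega
      _ = (2 ^ k * f + k + 2) * (c + 1 + roundCost m) := by ring
      _ ≤ (4 * (2 ^ k * f)) * (m * (1 * (c + 1 + roundCost 1) + (c + 1))) := by
        refine Nat.mul_le_mul (by omega) (h₄.trans (Nat.mul_le_mul_left _ (by omega)))
  have h₅ := key (inputEnd.cost + 1)
  have h₆ : ∀ a, m * a ≤ (2 ^ k * f) * (m * a) := fun a =>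
    Nat.le_mul_of_pos_left _ (by positivity)
  have h₇ := h₆ (inputEnd.cost + 1)
  have h₈ := h₆ (loadCost 1)
  have h₉ := h₆ (emitCost 1)
  unfold algorithmConstant
  calc _ ≤ (2 ^ k * f) * (m * (inputEnd.cost + 1)) + ((2 ^ k * f) * (m * loadCost 1) +
        (4 * (2 ^ k * f) * (m * roundsCost 1 1) + (2 ^ k * f) * (m * emitCost 1))) := by
        gcongr <;> omega
    _ = _ := by ring

section Correctness

variable {n : ℕ} {G : Digraph (Fin n)} {s t : Fin n} {f k : ℕ} {L : List (Fin n × Fin n)}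

theorem IsEdgeList.represents (hL : IsEdgeList G L) :
    (netOfList L).Represents Finset.univ G := by
  refine ⟨fun a b h => ?_, fun u v => ?_⟩
  · exact List.nodup_iff_injective_get.1 hL.1 h
  · have h₁ : G.Adj u v ↔ (u, v) ∈ L := (hL.2 (u, v)).symm
    rw [h₁, List.mem_iff_get]
    simp [netOfList, Prod.ext_iff]

theorem IsEdgeList.ncard_edges (hL : IsEdgeList G L) : (edges G).ncard = L.length := by
  have : edges G = (L.toFinset : Set (Fin n × Fin n)) := by
    ext e
    simp [hL.2 e]
  rw [this, Set.ncard_coe_finset, List.toFinset_card_of_nodup hL.1]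

theorem IsMaxFlowValue.ne (hf : IsMaxFlowValue G s t f) (hf₁ : 1 ≤ f) : s ≠ t := by
  rintro rfl
  obtain ⟨φ, hφ, hv⟩ := hf.1
  have h₁ : flowValue s φ = ∑ v, (∑ w, φ v w - ∑ u, φ u v) := by
    rw [Finset.sum_eq_single s]
    · rfl
    · intro v _ hvs
      rw [hφ.conserved v hvs hvs, sub_self]
    · simp
  rw [Finset.sum_sub_distrib, Finset.sum_comm, sub_self, hv] at h₁
  have : f = 0 := by exact_mod_cast h₁
  omega

/-- The subgraph formed by the edges with an index in `K`. -/
def subgraph {m : ℕ} (N : Net (Fin n) (Fin m)) (K : Finset (Fin m)) : Digraph (Fin n) where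
  Adj u v := ∃ e ∈ K, N.tail e = u ∧ N.head e = v

theorem isEdgeList_keptEdges {m : ℕ} {N : Net (Fin n) (Fin m)} (hN : N.Represents Finset.univ G)
    (K : Finset (Fin m)) : IsEdgeList (subgraph N K) (keptEdges N K m) := by
  have htake : (List.finRange m).take m = List.finRange m := List.take_of_length_le (by simp)
  refine ⟨?_, fun ⟨u, v⟩ => ?_⟩
  · exact ((List.nodup_finRange m).sublist (List.take_sublist _ _) |>.filter _).map hN.injective
  · simp [keptEdges, htake, edges, subgraph]

/-- The digraph formed by the edges that the algorithm prints has all the properties claimed. -/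
theorem Finished.correct {m : ℕ} {N : Net (Fin n) (Fin m)} {g : Fin m → ℤ} {K : Finset (Fin m)}
    (h : Finished N s t f k g) (hN : N.Represents Finset.univ G) (hst : s ≠ t)
    (hf : IsMaxFlowValue G s t f) (hf₁ : 1 ≤ f) (hK : ∀ e, e ∈ K ↔ N.head e ≠ t ∨ g e = 1) :
    IsFTRS G s (k + f - 1) (subgraph N K) ∧ inDegree (subgraph N K) t ≤ 2 ^ k * f := by
  obtain ⟨S, c, r, A, hS, hg, hA, hcut⟩ := h
  refine ⟨hN.isFTRS ⟨hN.injective, fun _ _ => Iff.rfl⟩ hf hf₁ hS hg hA hcut hK, ?_⟩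
  have h₁ := hN.inflow_le hst hf hS hg
  rw [hg.inflow_target] at h₁
  have h₂ : {u | (subgraph N K).Adj u t} ⊆
      ((Finset.univ.filter fun e => N.head e = t ∧ g e = 1).image N.tail : Finset (Fin n)) := by
    rintro u ⟨e, he, rfl, het⟩
    have := ((hK e).1 he).resolve_left (not_not.2 het)
    simp only [Finset.coe_image, Finset.coe_filter, Finset.mem_univ, true_and]
    exact ⟨e, ⟨het, this⟩, rfl⟩
  have h₃ := Set.ncard_le_ncard h₂ (Finset.finite_toSet _)
  rw [Set.ncard_coe_finset] at h₃
  have h₄ := h₃.trans Finset.card_image_le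
  exact h₄.trans (by exact_mod_cast h₁)

end Correctness

end Algorithm

end FTReach

open FTReach in
theorem mainTheorem4 :
    ∃ (P : FTReach.Prog) (C : ℕ),
      ∀ (n : ℕ) (G : Digraph (Fin n)) (s t : Fin n) (f k : ℕ) (L : List (Fin n × Fin n)),
        FTReach.IsEdgeList G L → 1 ≤ f → 1 ≤ k → FTReach.IsMaxFlowValue G s t (f : ℝ) →
        ∃ (H : Digraph (Fin n)) (M : List (Fin n × Fin n)),
          FTReach.IsEdgeList H M ∧
          FTReach.Computes P (FTReach.encodeInput L s t k)
            (C * (2 ^ k * f * (FTReach.edges G).ncard)) (FTReach.encodeEdges M) ∧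
          FTReach.IsFTRS G s (k + f - 1) H ∧
          FTReach.inDegree H t ≤ 2 ^ k * f := by
  refine ⟨algorithm, algorithmConstant, fun n G s t f k L hL hf₁ _ hf => ?_⟩
  have hN := hL.represents
  have hst := hf.ne hf₁
  -- Some edge enters `t`, since a cut around `t` has at least `f` edges.
  obtain ⟨e, he⟩ : ∃ e, (netOfList L).head e = t := by
    have h := hN.le_crossing hf (X := {t}ᶜ) (by simpa using hst) (by simp)
    obtain ⟨e, he⟩ := Finset.card_pos.1 (hf₁.trans h)
    simp only [Finset.mem_filter, Finset.mem_compl, Finset.mem_singleton, not_not] at he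
    exact ⟨e, he.2.2⟩
  have hm : 1 ≤ L.length := e.pos
  -- The final flow, and with it the set of the edges printed, comes out of the execution.
  have hrun : Triple (encodeInput L s t k) View.zero (.seq load (.seq rounds emitAll))
      (loadCost L.length + (roundsCost L.length (2 ^ k * f + k + 1) + emitCost L.length))
      fun h => ∃ g K, Finished (netOfList L) s t f k g ∧
        (∀ e, e ∈ K ↔ (netOfList L).head e ≠ t ∨ g e = 1) ∧
        h.out = encodeEdges (keptEdges (netOfList L) K L.length) := by
    refine load_triple.seq fun h₁ ⟨nx, fs, hS⟩ => ?_
    have hI := hS.isIncidence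
    refine (rounds_triple hI (he ▸ hI.fs_isSome (e, true) (Set.mem_univ _)) hst hN hf
      hS.mainState).seq fun h₂ ⟨hF, g, hg, hfin⟩ => ?_
    have hK : ∀ e, e ∈ (Finset.univ.filter fun e => (netOfList L).head e ≠ t ∨ g e = 1) ↔
        (netOfList L).head e ≠ t ∨ g e = 1 := by simp
    have h01 : ∀ e, g e = 1 ↔ g e ≠ 0 := by
      obtain ⟨S, c, r, A, -, hfl, -⟩ := hfin
      intro e
      rcases hfl.zero_or_one e with h | h <;> simp [h]
    refine (emitAll_triple hF hg (fun e => by rw [hK e, h01])).weaken le_rfl fun h₃ hout => ?_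
    exact ⟨g, _, hfin, hK, hout⟩
  have hend : inputEnd.eval (initState (encodeInput L s t k)) = (encodeInput L s t k).length := by
    rw [encodeInput_length]
    have : (encodeInput L s t k).getD 1 0 = L.length := rfl
    simp only [inputEnd, Expr.eval, initState, this]
    ring
  obtain ⟨O, ⟨g, K, hfin, hK, hO⟩, hcomp⟩ := computes_of_triple
    (Q := fun O => ∃ g K, Finished (netOfList L) s t f k g ∧
      (∀ e, e ∈ K ↔ (netOfList L).head e ≠ t ∨ g e = 1) ∧
      O = encodeEdges (keptEdges (netOfList L) K L.length)) hend hrun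
  obtain ⟨h₁, h₂⟩ := hfin.correct hN hst hf hf₁ hK
  obtain ⟨T, hT, τ, hx, hout⟩ := hcomp
  refine ⟨subgraph (netOfList L) K, keptEdges (netOfList L) K L.length,
    isEdgeList_keptEdges hN K, ⟨T, hT.trans ?_, τ, hx, hout.trans hO⟩, h₁, h₂⟩
  rw [hL.ncard_edges]
  exact algorithm_cost_le hm hf₁
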